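/- Let $1<p<\infty$, $p'=p/(p-1)$, let $0<r\le\infty$, $p\le s\le\infty$ satisfy $\frac1r+\frac1s<\frac23$, and let $q=ab$ with $a\in L_r(\mathbb R^3)$, $b\in L_s(\mathbb R^3)$ complex-valued. For a measurable function $u$ on $\mathbb R^3$ and $\nu,m>0$ put $M_{\nu,m}(u)=\sup_{x}\int_{|x-y|<1}|u(y)|^m|x-y|^{\nu-3}\,dy$. Assume that $M_{\nu,p'}(a)<\infty$ for some $0<\nu<p'$, that $M_{\mu,p}(b)<\infty$ for some $0<\mu<p$, and that $\int_{|x-y|<1}|q(y)|\,dy\to0$ as $|x|\to\infty$. Let $H_0=-\Delta$ in $L_p(\mathbb R^3)$ with domain the Sobolev space $W^2_p(\mathbb R^3)$, so that the spectrum of $H_0$ is $[0,\infty)$, let $R(z;H_0)=(H_0-z)^{-1}$, and let $A,B$ be the operators of multiplication by $a,b$ in $L_p(\mathbb R^3)$ with maximal domains. Let $Q(z)$ be the closure (bounded extension) of $BR(z;H_0)A$, and let $[R(z;H_0)A]$ be the closure (bounded extension) of $R(z;H_0)A$. The Schrödinger operator $H=-\Delta+q$ is the closed extension of $H_0+AB$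 in $L_p(\mathbb R^3)$ with $$(H-z)^{-1}=R(z;H_0)-[R(z;H_0)A]\,(I+Q(z))^{-1}BR(z;H_0)$$ for some $z\in\mathbb C\setminus[0,\infty)$ such that $I+Q(z)$ has a bounded inverse on $L_p(\mathbb R^3)$ (the operator $H$ does not depend on the choice of $z$). Then every eigenvalue $\lambda\in\mathbb C\setminus[0,\infty)$ of $H$ satisfies $$|\lambda|^{(3-\alpha)/2}\le(4\pi)^{1-\alpha}\,\Gamma(3-\alpha)\,\bigl(\alpha\sin(\theta/2)\bigr)^{\alpha-3}\,\|a\|_r^{\alpha}\,\|b\|_s^{\alpha},$$ where $\alpha=(1-\frac1r-\frac1s)^{-1}$ and $\theta=\arg\lambda\in(0,2\pi)$. -/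

import Mathlib

open MeasureTheory Filter Topology
open scoped ENNReal ContDiff

/-- Euclidean three-space. -/
abbrev E3 : Type := EuclideanSpace ℝ (Fin 3)

/-- The complex Lebesgue space `L_p(ℝ³)`. -/
abbrev LpC (p : ℝ≥0∞) : Type := Lp ℂ p (volume : Measure E3)

/-! ### Partially defined operators -/

section Operators

variable {E : Type*} [NormedAddCommGroup E] [NormedSpace ℂ E]

/-- The operator `T - z I`, on the domain of `T`. -/
def shiftOp (T : E →ₗ.[ℂ] E) (z : ℂ) : E →ₗ.[ℂ] E where
  domain := T.domain
  toFun := T.toFun - z • T.domain.subtype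

/-- The product `S T` of two partially defined operators, on its natural domain
`{x ∈ D(T) : T x ∈ D(S)}`. -/
def compOp (S T : E →ₗ.[ℂ] E) : E →ₗ.[ℂ] E :=
  S.comp (T.domRestrict ((S.domain.comap T.toFun).map T.domain.subtype)) (by
    rintro ⟨x, hx, hxT⟩
    obtain ⟨y, hy, rfl⟩ := hx
    exact hy)

/-- The resolvent `R(z; T) = (T - z I)⁻¹`, an operator on the range of `T - z I`. -/
noncomputable def resolventOp (T : E →ₗ.[ℂ] E) (z : ℂ) : E →ₗ.[ℂ] E :=
  (shiftOp T z).inverse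

/-- `z` is a regular point (a point of the resolvent set) of `T`: the operator `T - z I` maps the
domain of `T` one-to-one onto the whole space, and its inverse is bounded. -/
def IsRegularPoint (T : E →ₗ.[ℂ] E) (z : ℂ) : Prop :=
  ∃ S : E →L[ℂ] E, (∀ x : (shiftOp T z).domain, S (shiftOp T z x) = x) ∧
    ∀ y : E, ∃ h : S y ∈ (shiftOp T z).domain, shiftOp T z ⟨S y, h⟩ = y

/-- `z` is an eigenvalue of `T`. -/
def IsEigenvalueOf (T : E →ₗ.[ℂ] E) (z : ℂ) : Prop :=
  ∃ u : T.domain, (u : E) ≠ 0 ∧ T u = z • (u : E)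

theorem mem_compOp_domain_iff (S T : E →ₗ.[ℂ] E) (x : E) :
    x ∈ (compOp S T).domain ↔ ∃ h : x ∈ T.domain, T ⟨x, h⟩ ∈ S.domain := by
  constructor
  · rintro ⟨⟨y, hy, rfl⟩, h⟩
    exact ⟨y.2, hy⟩
  · rintro ⟨h, hS⟩
    exact ⟨⟨⟨x, h⟩, hS, rfl⟩, h⟩

theorem compOp_apply (S T : E →ₗ.[ℂ] E) (x : E) (hx : x ∈ (compOp S T).domain)
    (h : x ∈ T.domain) (hS : T ⟨x, h⟩ ∈ S.domain) :
    compOp S T ⟨x, hx⟩ = S ⟨T ⟨x, h⟩, hS⟩ := rfl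

end Operators

/-! ### The free operator and the multiplication operators -/

/-- The `i`-th partial derivative of a function on `ℝ³`. -/
noncomputable def partialDeriv (i : Fin 3) (φ : E3 → ℂ) (x : E3) : ℂ :=
  fderiv ℝ φ x (EuclideanSpace.single i 1)

/-- `d` is the weak `i`-th partial derivative of `u`:
`∫ u ∂ᵢφ = - ∫ d φ` for all test functions `φ ∈ C_c^∞(ℝ³)`. -/
def IsWeakPartial {p : ℝ≥0∞} (i : Fin 3) (u d : LpC p) : Prop :=
  ∀ φ : E3 → ℂ, ContDiff ℝ ∞ φ → HasCompactSupport φ →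
    ∫ x, u x * partialDeriv i φ x = - ∫ x, d x * φ x

theorem integrable_Lp_mul_test {p : ℝ≥0∞} [Fact (1 ≤ p)] (u : LpC p) {φ : E3 → ℂ}
    (hφ : Continuous φ) (hc : HasCompactSupport φ) : Integrable (fun x => u x * φ x) := by
  have h := ((Lp.memLp u).locallyIntegrable Fact.out).integrable_smul_right_of_hasCompactSupport
    hφ hc
  simpa [mul_comm] using h

theorem partialDeriv_continuous (i : Fin 3) {φ : E3 → ℂ} (hφ : ContDiff ℝ ∞ φ) :
    Continuous (partialDeriv i φ) :=
  (hφ.continuous_fderiv (by simp)).clm_apply continuous_const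

theorem partialDeriv_hasCompactSupport (i : Fin 3) {φ : E3 → ℂ} (hc : HasCompactSupport φ) :
    HasCompactSupport (partialDeriv i φ) :=
  hc.fderiv_apply (𝕜 := ℝ) _

theorem integral_add_mul_test {p : ℝ≥0∞} [Fact (1 ≤ p)] (u v : LpC p) {φ : E3 → ℂ}
    (hφ : Continuous φ) (hc : HasCompactSupport φ) :
    ∫ x, (u + v : LpC p) x * φ x = (∫ x, u x * φ x) + ∫ x, v x * φ x := by
  rw [← integral_add (integrable_Lp_mul_test u hφ hc) (integrable_Lp_mul_test v hφ hc)]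
  refine integral_congr_ae ?_
  filter_upwards [Lp.coeFn_add u v] with x hx
  rw [hx, Pi.add_apply, add_mul]

theorem integral_smul_mul_test {p : ℝ≥0∞} (c : ℂ) (u : LpC p) (φ : E3 → ℂ) :
    ∫ x, (c • u : LpC p) x * φ x = c * ∫ x, u x * φ x := by
  rw [← integral_const_mul]
  refine integral_congr_ae ?_
  filter_upwards [Lp.coeFn_smul c u] with x hx
  rw [hx, Pi.smul_apply, smul_eq_mul, mul_assoc]

theorem IsWeakPartial.add {p : ℝ≥0∞} [Fact (1 ≤ p)] {i : Fin 3} {u d v e : LpC p}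
    (h : IsWeakPartial i u d) (h' : IsWeakPartial i v e) : IsWeakPartial i (u + v) (d + e) := by
  intro φ hφ hc
  rw [integral_add_mul_test u v (partialDeriv_continuous i hφ)
    (partialDeriv_hasCompactSupport i hc), integral_add_mul_test d e hφ.continuous hc,
    h φ hφ hc, h' φ hφ hc]
  ring

theorem IsWeakPartial.smul {p : ℝ≥0∞} {i : Fin 3} {u d : LpC p} (c : ℂ)
    (h : IsWeakPartial i u d) : IsWeakPartial i (c • u) (c • d) := by
  intro φ hφ hc
  rw [integral_smul_mul_test, integral_smul_mul_test, h φ hφ hc]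
  ring

theorem IsWeakPartial.zero {p : ℝ≥0∞} (i : Fin 3) : IsWeakPartial i (0 : LpC p) 0 := by
  intro φ _ _
  have h (ψ : E3 → ℂ) : ∫ x, (0 : LpC p) x * ψ x = 0 := by simp
  rw [h, h, neg_zero]

theorem IsWeakPartial.eq_zero {p : ℝ≥0∞} [Fact (1 ≤ p)] {i : Fin 3} {d : LpC p}
    (h : IsWeakPartial i 0 d) : d = 0 := by
  rw [Lp.eq_zero_iff_ae_eq_zero]
  refine ae_eq_zero_of_integral_contDiff_smul_eq_zero
    ((Lp.memLp d).locallyIntegrable Fact.out) ?_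
  intro g hg hc
  have h0 (ψ : E3 → ℂ) : ∫ x, (0 : LpC p) x * ψ x = 0 := by simp
  have := h (fun x => (g x : ℂ)) (Complex.ofRealCLM.contDiff.comp hg)
    (hc.comp_left (g := fun t : ℝ => (t : ℂ)) (by simp))
  rw [h0] at this
  have h2 := neg_eq_zero.mp this.symm
  rw [← h2]
  refine integral_congr_ae (Eventually.of_forall fun x => ?_)
  simp [mul_comm]

/-- The graph of the free operator: the pairs `(u, -Δu)` with `u` in the Sobolev space
`W_p²(ℝ³)`, that is, with all weak partial derivatives of `u` of orders one and two in `L_p(ℝ³)`. -/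
def freeGraph (p : ℝ≥0∞) [Fact (1 ≤ p)] : Submodule ℂ (LpC p × LpC p) where
  carrier := {w | ∃ (d : Fin 3 → LpC p) (dd : Fin 3 → Fin 3 → LpC p),
    (∀ i, IsWeakPartial i w.1 (d i)) ∧ (∀ i j, IsWeakPartial j (d i) (dd i j)) ∧
    w.2 = - ∑ i, dd i i}
  add_mem' := by
    rintro ⟨u, f⟩ ⟨v, g⟩ ⟨d, dd, h1, h2, h3⟩ ⟨e, ee, k1, k2, k3⟩
    refine ⟨d + e, dd + ee, fun i => (h1 i).add (k1 i), fun i j => (h2 i j).add (k2 i j), ?_⟩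
    simp only at h3 k3
    simp only [Prod.mk_add_mk, h3, k3, Pi.add_apply, Finset.sum_add_distrib, neg_add]
  zero_mem' := ⟨0, 0, fun i => IsWeakPartial.zero i, fun _ j => IsWeakPartial.zero j, by simp⟩
  smul_mem' := by
    rintro c ⟨u, f⟩ ⟨d, dd, h1, h2, h3⟩
    refine ⟨c • d, c • dd, fun i => (h1 i).smul c, fun i j => (h2 i j).smul c, ?_⟩
    simp only at h3
    simp only [Prod.smul_mk, h3, Pi.smul_apply, smul_neg, Finset.smul_sum]

theorem freeGraph_snd_eq_zero (p : ℝ≥0∞) [Fact (1 ≤ p)] (w : LpC p × LpC p)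
    (hw : w ∈ freeGraph p) (h0 : w.1 = 0) : w.2 = 0 := by
  obtain ⟨d, dd, h1, h2, h3⟩ := hw
  have hd : ∀ i, d i = 0 := fun i => by
    have := h1 i
    rw [h0] at this
    exact this.eq_zero
  have hdd : ∀ i j, dd i j = 0 := fun i j => by
    have := h2 i j
    rw [hd i] at this
    exact this.eq_zero
  rw [h3]
  simp [hdd]

/-- The free operator `H₀ = -Δ` in `L_p(ℝ³)`, with domain the Sobolev space `W_p²(ℝ³)`. -/
noncomputable def freeOp (p : ℝ≥0∞) [Fact (1 ≤ p)] : LpC p →ₗ.[ℂ] LpC p :=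
  (freeGraph p).toLinearPMap

theorem freeOp_graph (p : ℝ≥0∞) [Fact (1 ≤ p)] : (freeOp p).graph = freeGraph p :=
  Submodule.toLinearPMap_graph_eq _ (freeGraph_snd_eq_zero p)

/-- The graph of multiplication by `a`: the pairs `(u, a u)` with `u` and `a u` in `L_p(ℝ³)`. -/
def mulGraph (p : ℝ≥0∞) (a : E3 → ℂ) : Submodule ℂ (LpC p × LpC p) where
  carrier := {w | w.2 =ᵐ[volume] fun x => a x * w.1 x}
  add_mem' := by
    rintro ⟨u, f⟩ ⟨v, g⟩ h k
    simp only [Set.mem_ofPred_eq] at h k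
    show (f + g : LpC p) =ᵐ[volume] fun x => a x * (u + v : LpC p) x
    filter_upwards [h, k, Lp.coeFn_add f g, Lp.coeFn_add u v] with x h1 h2 h3 h4
    rw [h3, h4, Pi.add_apply, Pi.add_apply, h1, h2, mul_add]
  zero_mem' := by
    show (0 : LpC p) =ᵐ[volume] fun x => a x * (0 : LpC p) x
    filter_upwards [Lp.coeFn_zero ℂ p (volume : Measure E3)] with x hx
    rw [hx, Pi.zero_apply, mul_zero]
  smul_mem' := by
    rintro c ⟨u, f⟩ h
    simp only [Set.mem_ofPred_eq] at h
    show (c • f : LpC p) =ᵐ[volume] fun x => a x * (c • u : LpC p) x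
    filter_upwards [h, Lp.coeFn_smul c f, Lp.coeFn_smul c u] with x h1 h2 h3
    rw [h2, h3, Pi.smul_apply, Pi.smul_apply, h1, smul_eq_mul, smul_eq_mul]
    ring

theorem mulGraph_snd_eq_zero (p : ℝ≥0∞) (a : E3 → ℂ) (w : LpC p × LpC p)
    (hw : w ∈ mulGraph p a) (h0 : w.1 = 0) : w.2 = 0 := by
  obtain ⟨u, f⟩ := w
  simp only at h0
  subst h0
  rw [Lp.eq_zero_iff_ae_eq_zero]
  have hw' : f =ᵐ[volume] fun x => a x * (0 : LpC p) x := hw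
  filter_upwards [hw', Lp.coeFn_zero ℂ p (volume : Measure E3)] with x hx h0
  simp only [hx, h0, Pi.zero_apply, mul_zero]

/-- The operator of multiplication by `a` in `L_p(ℝ³)`, with its maximal domain. -/
noncomputable def mulOp (p : ℝ≥0∞) [Fact (1 ≤ p)] (a : E3 → ℂ) : LpC p →ₗ.[ℂ] LpC p :=
  (mulGraph p a).toLinearPMap

theorem mulOp_graph (p : ℝ≥0∞) [Fact (1 ≤ p)] (a : E3 → ℂ) : (mulOp p a).graph = mulGraph p a :=
  Submodule.toLinearPMap_graph_eq _ (mulGraph_snd_eq_zero p a)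

/-! ### The Schrödinger operator -/

/-- The bordered resolvent `Q(z)`: the closure (bounded extension) of `B R(z; H₀) A`, where `A` and
`B` are the operators of multiplication by `a` and `b`. -/
noncomputable def borderedResolvent (p : ℝ≥0∞) [Fact (1 ≤ p)] (a b : E3 → ℂ) (z : ℂ) :
    LpC p →ₗ.[ℂ] LpC p :=
  (compOp (mulOp p b) (compOp (resolventOp (freeOp p) z) (mulOp p a))).closure

/-- The closure (bounded extension) of `R(z; H₀) A`. -/
noncomputable def halfBorderedResolvent (p : ℝ≥0∞) [Fact (1 ≤ p)] (a : E3 → ℂ) (z : ℂ) :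
    LpC p →ₗ.[ℂ] LpC p :=
  (compOp (resolventOp (freeOp p) z) (mulOp p a)).closure

/-- The perturbed resolvent `R(z; H₀) - [R(z; H₀) A] (I + Q(z))⁻¹ B R(z; H₀)`, with `[·]` denoting
the closure. -/
noncomputable def perturbedResolvent (p : ℝ≥0∞) [Fact (1 ≤ p)] (a b : E3 → ℂ) (z : ℂ) :
    LpC p →ₗ.[ℂ] LpC p :=
  resolventOp (freeOp p) z -
    compOp (halfBorderedResolvent p a z)
      (compOp (resolventOp (borderedResolvent p a b z) (-1))
        (compOp (mulOp p b) (resolventOp (freeOp p) z)))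

/-- `H` is the Schrödinger operator in `L_p(ℝ³)` realized by `-Δ + a b`: the closed extension of
`H₀ + A B` whose resolvent is
`(H - z)⁻¹ = R(z; H₀) - [R(z; H₀) A] (I + Q(z))⁻¹ B R(z; H₀)`, i.e.
`H = z + (R(z; H₀) - [R(z; H₀) A] (I + Q(z))⁻¹ B R(z; H₀))⁻¹`.
Here `z` is a point outside the spectrum `[0, ∞)` of `H₀` for which `I + Q(z)` is boundedly
invertible; by the resolvent identity the operator does not depend on the choice of `z`. -/
def IsSchrodingerOperator (p : ℝ≥0∞) [Fact (1 ≤ p)] (a b : E3 → ℂ)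
    (H : LpC p →ₗ.[ℂ] LpC p) : Prop :=
  ∃ z : ℂ, z ∉ ((↑) : ℝ → ℂ) '' Set.Ici 0 ∧ IsRegularPoint (borderedResolvent p a b z) (-1) ∧
    H = shiftOp (perturbedResolvent p a b z).inverse (-z)

/-! ### Stummel classes -/

/-- The Stummel functional `M_{ν,m}(u) = sup_x ∫_{|x-y|<1} |u(y)|^m |x-y|^{ν-3} dy` on `ℝ³`. -/
noncomputable def stummel (ν m : ℝ) (u : E3 → ℂ) : ℝ≥0∞ :=
  ⨆ x : E3, ∫⁻ y in Metric.ball x 1, ‖u y‖ₑ ^ m * ENNReal.ofReal (‖x - y‖ ^ (ν - 3))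

/-! Write `λ = ζ²` with `κ = Im ζ = √|λ| sin (θ/2) > 0`. An eigenfunction satisfies `u = -G ∗ (q
u)`, where the Green kernel `G` of `-Δ - ζ²` has modulus `Y_κ(x) = exp (-κ|x|) / (4π|x|)`. Hence `g
= q u` obeys `|g| ≤ |q| (Y_κ ∗ |g|)`. If `g` were integrable, integrating this in `x` and applying
Hölder with `1/ρ = 1/r + 1/s = 1 - 1/α` would give `1 ≤ ‖q‖_ρ ‖Y_κ‖_α`. The norm of `Y_κ` is an
explicit Gamma integral (`integral_yukawa_rpow`), finite because `α < 3`; the bound is the `α`-th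
power of this inequality, combined with `‖q‖_ρ ≤ ‖a‖_r ‖b‖_s`.

However, `g = a (b u)` with `b u ∈ L_p`, and the Stummel condition puts `a` in `L_{p'}` only
locally, though uniformly so. The integration is therefore done against `exp (-c|x|)`, which makes
`g` integrable for every `c > 0`. Moving the weight through the convolution replaces `κ` by `κ - c`
(`lintegral_exp_mul_yukawa_potential_le`, `one_le_eLpNorm_mul_eLpNorm_yukawa`), and `c → 0` at the
end (`one_le_rpow_bound`).

The remaining work derives the integral equation from the definition of `H`. The kernel is shown to
be a fundamental solution (`integral_greenKernel_mul_helmholtz`), and a distributional solution that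
is integrable against all exponential weights is shown to be the Green potential of its right-hand
side (`IsVeryWeakSol.ae_eq_greenConv`). This identifies `R(z; H₀) A`, and `w ↦ β · G ∗ (a w)` is
closed in `L_p` (`ExpMemLp.ae_eq_of_tendsto`), so the closures in the definition are given by the
same formulas. If `u` is the perturbed resolvent applied to `g`, then `w = (I + Q)⁻¹ B R g` turns
out to be `b u`, and `-Δu - zu = g - a w`. With `g = (λ - z) u` this is the eigenvalue equation.
Only one inclusion between graphs is ever needed: membership in an operator's graph implies the
formula. -/

/-! ### The Yukawa kernel -/

/-- The modulus `exp (-κ|x|) / (4π|x|)` of the kernel of the free resolvent. -/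
noncomputable def yukawa (κ : ℝ) (x : E3) : ℝ := Real.exp (-κ * ‖x‖) / (4 * Real.pi * ‖x‖)

theorem yukawa_nonneg (κ : ℝ) (x : E3) : 0 ≤ yukawa κ x := by
  unfold yukawa; positivity

theorem measurable_yukawa (κ : ℝ) : Measurable (yukawa κ) := by
  unfold yukawa; fun_prop

/-- An exponential weight costs only decay rate; every weighted estimate below uses this. -/
theorem exp_mul_yukawa (c κ : ℝ) (x : E3) :
    Real.exp (c * ‖x‖) * yukawa κ x = yukawa (κ - c) x := by
  unfold yukawa
  rw [← mul_div_assoc, ← Real.exp_add]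
  ring_nf

/-- The factor `t ^ 2` is the radial density in dimension three; the exponent `(3 - α) - 1` is the
form in which the Gamma integral is stated. -/
theorem yukawa_rpow_radial {κ α t : ℝ} (ht : 0 < t) :
    t ^ 2 * (Real.exp (-κ * t) / (4 * Real.pi * t)) ^ α =
      (4 * Real.pi) ^ (-α) * (t ^ ((3 - α) - 1) * Real.exp (-(α * κ * t))) := by
  have hpi : 0 < 4 * Real.pi := by positivity
  rw [Real.div_rpow (Real.exp_nonneg _) (by positivity), Real.mul_rpow hpi.le ht.le,
    ← Real.exp_mul, Real.rpow_neg hpi.le, show (3 - α) - 1 = (2 : ℕ) - α by push_cast; ring,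
    Real.rpow_sub ht, Real.rpow_natCast, show -κ * t * α = -(α * κ * t) by ring]
  field_simp

theorem integrable_yukawa_rpow {κ α : ℝ} (hκ : 0 < κ) (hα : 0 < α) (hα3 : α < 3) :
    Integrable (fun x => yukawa κ x ^ α) := by
  have h := integrable_fun_norm_addHaar (volume : Measure E3)
    (f := fun t => (Real.exp (-κ * t) / (4 * Real.pi * t)) ^ α)
  refine h.2 ?_
  have h1 : IntegrableOn (fun t : ℝ => t ^ ((3 - α) - 1) * Real.exp (-(α * κ * t)))
      (Set.Ioi 0) := by
    -- The requirement `-1 < s` is `α < 3`: the singularity `|x|^(-α)` must be locally integrable.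
    have := integrableOn_rpow_mul_exp_neg_mul_rpow (s := (3 - α) - 1) (p := 1) (b := α * κ)
      (by linarith) one_pos (by positivity)
    refine this.congr_fun (fun t _ => ?_) measurableSet_Ioi
    simp
  refine IntegrableOn.congr_fun (h1.const_mul ((4 * Real.pi) ^ (-α))) (fun t ht => ?_)
    measurableSet_Ioi
  simp only [finrank_euclideanSpace, Fintype.card_fin, smul_eq_mul]
  exact (yukawa_rpow_radial ht).symm

/-- In polar coordinates the sphere contributes `4π`, the kernel `(4π)^(-α)`, and the radial
integral is `Γ(3 - α) (ακ)^(α - 3)`. -/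
theorem integral_yukawa_rpow {κ α : ℝ} (hκ : 0 < κ) (hα : 0 < α) (hα3 : α < 3) :
    ∫ x, yukawa κ x ^ α =
      (4 * Real.pi) ^ (1 - α) * Real.Gamma (3 - α) * (α * κ) ^ (α - 3) := by
  have hpi : 0 < 4 * Real.pi := by positivity
  have h := integral_fun_norm_addHaar (volume : Measure E3)
    (f := fun t => (Real.exp (-κ * t) / (4 * Real.pi * t)) ^ α)
  unfold yukawa
  rw [h, setIntegral_congr_fun (g := fun t => (4 * Real.pi) ^ (-α) *
    (t ^ ((3 - α) - 1) * Real.exp (-(α * κ * t)))) measurableSet_Ioi, integral_const_mul,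
    Real.integral_rpow_mul_exp_neg_mul_Ioi (by linarith) (by positivity)]
  · have hv : (volume : Measure E3).real (Metric.ball 0 1) = Real.pi * 4 / 3 := by
      rw [Measure.real, EuclideanSpace.volume_ball_fin_three]
      simp only [ENNReal.ofReal_one, one_pow, one_mul]
      exact ENNReal.toReal_ofReal (by positivity)
    rw [hv, finrank_euclideanSpace, Fintype.card_fin, smul_eq_mul, nsmul_eq_mul,
      one_div, Real.inv_rpow (by positivity), ← Real.rpow_neg (by positivity), neg_sub,
      Real.rpow_sub hpi 1 α, Real.rpow_one, Real.rpow_neg hpi.le]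
    push_cast
    ring
  · intro t ht
    simp only [finrank_euclideanSpace, Fintype.card_fin, smul_eq_mul]
    exact yukawa_rpow_radial ht

theorem integrable_yukawa {κ : ℝ} (hκ : 0 < κ) : Integrable (yukawa κ) := by
  simpa using integrable_yukawa_rpow hκ one_pos (by norm_num)

theorem eLpNorm_yukawa {κ α : ℝ} (hκ : 0 < κ) (hα : 0 < α) (hα3 : α < 3) :
    eLpNorm (yukawa κ) (ENNReal.ofReal α) volume =
      ENNReal.ofReal (((4 * Real.pi) ^ (1 - α) * Real.Gamma (3 - α) *
        (α * κ) ^ (α - 3)) ^ α⁻¹) := by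
  rw [eLpNorm_eq_lintegral_rpow_enorm_toReal (by simpa using hα) ENNReal.ofReal_ne_top,
    ENNReal.toReal_ofReal hα.le, ← integral_yukawa_rpow hκ hα hα3,
    ← ENNReal.ofReal_rpow_of_nonneg
      (integral_nonneg fun x => Real.rpow_nonneg (yukawa_nonneg κ x) α) (by positivity),
    ofReal_integral_eq_lintegral_ofReal (integrable_yukawa_rpow hκ hα hα3)
      (Eventually.of_forall fun x => Real.rpow_nonneg (yukawa_nonneg κ x) α), one_div]
  congr 2
  ext x
  rw [Real.enorm_of_nonneg (yukawa_nonneg κ x), ENNReal.ofReal_rpow_of_nonneg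
    (yukawa_nonneg κ x) hα.le]

/-- The kernel `exp (iζ|x|) / (4π|x|)` of the free resolvent `(-Δ - ζ²)⁻¹`. -/
noncomputable def greenKernel (ζ : ℂ) (x : E3) : ℂ :=
  Complex.exp (Complex.I * ζ * ‖x‖) / (4 * Real.pi * ‖x‖)

theorem norm_greenKernel (ζ : ℂ) (x : E3) : ‖greenKernel ζ x‖ = yukawa ζ.im x := by
  unfold greenKernel yukawa
  rw [norm_div, Complex.norm_exp]
  congr 1
  · simp
  · simp [abs_of_pos Real.pi_pos]

theorem greenKernel_neg (ζ : ℂ) (x : E3) : greenKernel ζ (-x) = greenKernel ζ x := by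
  simp [greenKernel]

theorem measurable_greenKernel (ζ : ℂ) : Measurable (greenKernel ζ) := by
  unfold greenKernel; fun_prop

theorem integrable_greenKernel {ζ : ℂ} (hζ : 0 < ζ.im) : Integrable (greenKernel ζ) := by
  refine (integrable_yukawa hζ).mono (measurable_greenKernel ζ).aestronglyMeasurable ?_
  filter_upwards with x
  rw [norm_greenKernel]
  exact le_abs_self _

/-- The differential expression `-Δχ - zχ`. -/
noncomputable def helmholtz (z : ℂ) (χ : E3 → ℂ) (x : E3) : ℂ :=
  -(∑ i, partialDeriv i (partialDeriv i χ) x) - z * χ x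

/-! ### Derivatives of test functions and symmetry of `-Δ - z`. -/

theorem contDiff_partialDeriv (i : Fin 3) {φ : E3 → ℂ} (hφ : ContDiff ℝ ∞ φ) :
    ContDiff ℝ ∞ (partialDeriv i φ) :=
  (hφ.fderiv_right (m := ∞) (by simp)).clm_apply contDiff_const

theorem continuous_helmholtz (z : ℂ) {χ : E3 → ℂ} (hχ : ContDiff ℝ ∞ χ) :
    Continuous (helmholtz z χ) := by
  have := fun i => partialDeriv_continuous i (contDiff_partialDeriv i hχ)
  have := hχ.continuous
  unfold helmholtz
  fun_prop

theorem hasCompactSupport_helmholtz (z : ℂ) {χ : E3 → ℂ} (hc : HasCompactSupport χ) :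
    HasCompactSupport (helmholtz z χ) := by
  refine hc.mono' fun x hx => ?_
  contrapose hx
  have h0 : ∀ i, partialDeriv i (partialDeriv i χ) x = 0 := fun i =>
    image_eq_zero_of_notMem_tsupport fun h =>
      hx (tsupport_fderiv_apply_subset ℝ _ (tsupport_fderiv_apply_subset ℝ _ h))
  simp [helmholtz, h0, image_eq_zero_of_notMem_tsupport hx]

theorem integral_mul_partialDeriv (i : Fin 3) {f g : E3 → ℂ} (hf : ContDiff ℝ ∞ f)
    (hg : ContDiff ℝ ∞ g) (hc : HasCompactSupport g) :
    ∫ x, f x * partialDeriv i g x = -∫ x, partialDeriv i f x * g x := by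
  refine integral_mul_fderiv_eq_neg_fderiv_mul_of_integrable ?_ ?_ ?_
    (fun x _ => hf.differentiable (by simp) x) (fun x _ => hg.differentiable (by simp) x)
  · exact (((partialDeriv_continuous i hf).mul hg.continuous).integrable_of_hasCompactSupport
      hc.mul_left)
  · exact ((hf.continuous.mul (partialDeriv_continuous i hg)).integrable_of_hasCompactSupport
      (partialDeriv_hasCompactSupport i hc).mul_left)
  · exact ((hf.continuous.mul hg.continuous).integrable_of_hasCompactSupport hc.mul_left)

theorem integral_mul_helmholtz {f g : E3 → ℂ} (z : ℂ) (hf : ContDiff ℝ ∞ f)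
    (hg : ContDiff ℝ ∞ g) (hc : HasCompactSupport g) :
    ∫ x, f x * helmholtz z g x = ∫ x, helmholtz z f x * g x := by
  have h1 : ∀ i, ∫ x, f x * partialDeriv i (partialDeriv i g) x =
      ∫ x, partialDeriv i (partialDeriv i f) x * g x := fun i => by
    rw [integral_mul_partialDeriv i hf (contDiff_partialDeriv i hg)
      (partialDeriv_hasCompactSupport i hc), integral_mul_partialDeriv i
      (contDiff_partialDeriv i hf) hg hc, neg_neg]
  have i1 : ∀ i, Integrable fun x => f x * partialDeriv i (partialDeriv i g) x := fun i =>
    (hf.continuous.mul (partialDeriv_continuous i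
      (contDiff_partialDeriv i hg))).integrable_of_hasCompactSupport
      (partialDeriv_hasCompactSupport i (partialDeriv_hasCompactSupport i hc)).mul_left
  have i2 : ∀ i, Integrable fun x => partialDeriv i (partialDeriv i f) x * g x := fun i =>
    ((partialDeriv_continuous i (contDiff_partialDeriv i hf)).mul
      hg.continuous).integrable_of_hasCompactSupport hc.mul_left
  have i3 : Integrable fun x => z * (f x * g x) :=
    ((hf.continuous.mul hg.continuous).integrable_of_hasCompactSupport hc.mul_left).const_mul z
  calc ∫ x, f x * helmholtz z g x
      = ∫ x, (-(∑ i, f x * partialDeriv i (partialDeriv i g) x) - z * (f x * g x)) := by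
        congr 1; ext x; simp only [helmholtz, mul_sub, Finset.mul_sum, mul_neg]; ring
    _ = ∫ x, (-(∑ i, partialDeriv i (partialDeriv i f) x * g x) - z * (f x * g x)) := by
        have j1 := (integrable_finsetSum Finset.univ fun i _ => i1 i).fun_neg
        have j2 := (integrable_finsetSum Finset.univ fun i _ => i2 i).fun_neg
        rw [integral_sub j1 i3, integral_sub j2 i3, integral_neg, integral_neg,
          integral_finsetSum _ fun i _ => i1 i,
          integral_finsetSum _ fun i _ => i2 i]
        simp only [h1]
    _ = _ := by
        congr 1; ext x; simp only [helmholtz, sub_mul, Finset.sum_mul, neg_mul]; ring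

/-! ### The fundamental solution of the Helmholtz equation -/

theorem partialDeriv_mul (i : Fin 3) {f g : E3 → ℂ} {x : E3} (hf : DifferentiableAt ℝ f x)
    (hg : DifferentiableAt ℝ g x) :
    partialDeriv i (fun y => f y * g y) x = partialDeriv i f x * g x + f x * partialDeriv i g x := by
  unfold partialDeriv
  rw [fderiv_fun_mul hf hg]
  simp
  ring

theorem hasFDerivAt_comp_normSq {g : ℝ → ℂ} {g' : ℂ} {c : ℝ} {x : E3}
    (h : HasDerivAt g g' (‖x‖ ^ 2 + c)) :
    HasFDerivAt (fun y : E3 => g (‖y‖ ^ 2 + c))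
      ((ContinuousLinearMap.toSpanSingleton ℝ g').comp (2 • innerSL ℝ x)) x := by
  have h1 : HasFDerivAt (fun y : E3 => ‖y‖ ^ 2 + c) (2 • innerSL ℝ x) x :=
    ((hasStrictFDerivAt_norm_sq x).hasFDerivAt).add_const c
  exact h.hasFDerivAt.comp x h1

theorem partialDeriv_comp_normSq (i : Fin 3) {g : ℝ → ℂ} {g' : ℂ} {c : ℝ} {x : E3}
    (h : HasDerivAt g g' (‖x‖ ^ 2 + c)) :
    partialDeriv i (fun y : E3 => g (‖y‖ ^ 2 + c)) x = 2 * (x i : ℂ) * g' := by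
  unfold partialDeriv
  rw [(hasFDerivAt_comp_normSq h).fderiv]
  simp [EuclideanSpace.inner_single_right, mul_assoc]

theorem partialDeriv_coord (i : Fin 3) (x : E3) :
    partialDeriv i (fun y : E3 => 2 * (y i : ℂ)) x = 2 := by
  have h : HasFDerivAt (fun y : E3 => 2 * (y i : ℂ))
      ((2 : ℂ) • (Complex.ofRealCLM.comp (EuclideanSpace.proj i : E3 →L[ℝ] ℝ))) x :=
    (Complex.ofRealCLM.hasFDerivAt.comp x
      (EuclideanSpace.proj i : E3 →L[ℝ] ℝ).hasFDerivAt).const_mul (2 : ℂ)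
  unfold partialDeriv
  rw [h.fderiv]
  simp

/-- The profile of the Green kernel as a function of the squared radius. -/
noncomputable def greenProfile (ζ : ℂ) (t : ℝ) : ℂ :=
  Complex.exp (Complex.I * ζ * (√t : ℝ)) / (4 * Real.pi * (√t : ℝ))

/-- The derivative of `greenProfile`. -/
noncomputable def greenProfileDeriv (ζ : ℂ) (t : ℝ) : ℂ :=
  Complex.exp (Complex.I * ζ * (√t : ℝ)) *
    ((Complex.I * ζ * (√t : ℝ) - 1) / (8 * Real.pi * (√t : ℝ) ^ 3))

/-- The second derivative of `greenProfile`. -/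
noncomputable def greenProfileDeriv₂ (ζ : ℂ) (t : ℝ) : ℂ :=
  Complex.exp (Complex.I * ζ * (√t : ℝ)) *
    ((-ζ ^ 2 * (√t : ℝ) ^ 2 - 3 * Complex.I * ζ * (√t : ℝ) + 3) /
      (16 * Real.pi * (√t : ℝ) ^ 5))

theorem hasDerivAt_ofReal_sqrt {t : ℝ} (ht : 0 < t) :
    HasDerivAt (fun t : ℝ => ((√t : ℝ) : ℂ)) (1 / (2 * (√t : ℝ))) t := by
  simpa using (Real.hasDerivAt_sqrt ht.ne').ofReal_comp

theorem hasDerivAt_greenProfile (ζ : ℂ) {t : ℝ} (ht : 0 < t) :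
    HasDerivAt (greenProfile ζ) (greenProfileDeriv ζ t) t := by
  have hs := hasDerivAt_ofReal_sqrt ht
  have h0 : ((√t : ℝ) : ℂ) ≠ 0 := by exact_mod_cast (Real.sqrt_pos.2 ht).ne'
  have hpi : (Real.pi : ℂ) ≠ 0 := by exact_mod_cast Real.pi_ne_zero
  refine ((hs.const_mul (Complex.I * ζ)).cexp.div (hs.const_mul (4 * Real.pi : ℂ))
    (by simp [hpi, h0])).congr_deriv ?_
  unfold greenProfileDeriv
  generalize ((√t : ℝ) : ℂ) = s at *
  generalize Complex.exp (Complex.I * ζ * s) = e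
  field_simp
  ring

theorem hasDerivAt_greenProfileDeriv (ζ : ℂ) {t : ℝ} (ht : 0 < t) :
    HasDerivAt (greenProfileDeriv ζ) (greenProfileDeriv₂ ζ t) t := by
  have hs := hasDerivAt_ofReal_sqrt ht
  have h0 : ((√t : ℝ) : ℂ) ≠ 0 := by exact_mod_cast (Real.sqrt_pos.2 ht).ne'
  have hpi : (Real.pi : ℂ) ≠ 0 := by exact_mod_cast Real.pi_ne_zero
  refine ((hs.const_mul (Complex.I * ζ)).cexp.fun_mul
    (((hs.const_mul (Complex.I * ζ)).sub_const 1).fun_div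
      ((hs.fun_pow 3).const_mul (8 * Real.pi : ℂ))
    (by simp [hpi, h0]))).congr_deriv ?_
  unfold greenProfileDeriv₂
  generalize ((√t : ℝ) : ℂ) = s at *
  generalize Complex.exp (Complex.I * ζ * s) = e
  simp only [Nat.add_one_sub_one, Nat.cast_ofNat]
  field_simp
  linear_combination (16 * e * s ^ 2 * ζ ^ 2) * Complex.I_sq

/-- The Green kernel with the radius `|x|` replaced by `(|x|² + ε²)^(1/2)`. -/
noncomputable def regGreen (ζ : ℂ) (ε : ℝ) (x : E3) : ℂ := greenProfile ζ (‖x‖ ^ 2 + ε ^ 2)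

theorem contDiff_regGreen (ζ : ℂ) {ε : ℝ} (hε : 0 < ε) : ContDiff ℝ ∞ (regGreen ζ ε) := by
  have hp : ∀ x : E3, 0 < ‖x‖ ^ 2 + ε ^ 2 := fun x => by positivity
  have h1 : ContDiff ℝ ∞ (fun x : E3 => √(‖x‖ ^ 2 + ε ^ 2)) :=
    ((contDiff_norm_sq ℝ).add contDiff_const).sqrt fun x => (hp x).ne'
  have h2 : ContDiff ℝ ∞ (fun x : E3 => ((√(‖x‖ ^ 2 + ε ^ 2) : ℝ) : ℂ)) :=
    Complex.ofRealCLM.contDiff.comp h1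
  have h3 : ContDiff ℝ ∞ (fun x : E3 =>
      Complex.exp (Complex.I * ζ * ((√(‖x‖ ^ 2 + ε ^ 2) : ℝ) : ℂ))) :=
    (contDiff_const.mul h2).cexp
  have h4 : ContDiff ℝ ∞ (fun x : E3 => 4 * (Real.pi : ℂ) * ((√(‖x‖ ^ 2 + ε ^ 2) : ℝ) : ℂ)) :=
    contDiff_const.mul h2
  have h5 : ∀ x : E3, 4 * (Real.pi : ℂ) * ((√(‖x‖ ^ 2 + ε ^ 2) : ℝ) : ℂ) ≠ 0 := fun x => by
    have h0 : ((√(‖x‖ ^ 2 + ε ^ 2) : ℝ) : ℂ) ≠ 0 := by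
      exact_mod_cast (Real.sqrt_pos.2 (hp x)).ne'
    simp [Real.pi_ne_zero, h0]
  exact h3.mul (h4.inv h5)

/-- For `F(t)` with `t = |x|² + ε²` the Laplacian is `6F' + 4|x|²F''`. The exact profile satisfies
`6F' + 4tF'' = -ζ²F`, so replacing `|x|²` by `t - ε²` leaves only the defect `4ε²F''`. -/
theorem helmholtz_regGreen (ζ : ℂ) {ε : ℝ} (hε : 0 < ε) (x : E3) :
    helmholtz (ζ ^ 2) (regGreen ζ ε) x =
      4 * ε ^ 2 * greenProfileDeriv₂ ζ (‖x‖ ^ 2 + ε ^ 2) := by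
  have hp : ∀ x : E3, 0 < ‖x‖ ^ 2 + ε ^ 2 := fun x => by positivity
  have h1 : ∀ i, partialDeriv i (regGreen ζ ε) =
      fun y => 2 * (y i : ℂ) * greenProfileDeriv ζ (‖y‖ ^ 2 + ε ^ 2) := fun i => by
    ext y
    exact partialDeriv_comp_normSq i (hasDerivAt_greenProfile ζ (hp y))
  have h2 : ∀ i, partialDeriv i (partialDeriv i (regGreen ζ ε)) x =
      2 * greenProfileDeriv ζ (‖x‖ ^ 2 + ε ^ 2) +
        4 * (x i : ℂ) ^ 2 * greenProfileDeriv₂ ζ (‖x‖ ^ 2 + ε ^ 2) := fun i => by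
    have hd := hasDerivAt_greenProfileDeriv ζ (hp x)
    rw [h1, partialDeriv_mul i (by fun_prop) (hasFDerivAt_comp_normSq hd).differentiableAt,
      partialDeriv_coord, partialDeriv_comp_normSq i hd]
    ring
  have h3 : (‖x‖ : ℂ) ^ 2 = ∑ i, (x i : ℂ) ^ 2 := by
    have := EuclideanSpace.real_norm_sq_eq x
    exact_mod_cast this
  have h4 : ((√(‖x‖ ^ 2 + ε ^ 2) : ℝ) : ℂ) ^ 2 = (‖x‖ : ℂ) ^ 2 + (ε : ℂ) ^ 2 := by
    have := Real.sq_sqrt (hp x).le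
    exact_mod_cast this
  have h0 : ((√(‖x‖ ^ 2 + ε ^ 2) : ℝ) : ℂ) ≠ 0 := by
    exact_mod_cast (Real.sqrt_pos.2 (hp x)).ne'
  have hpi : (Real.pi : ℂ) ≠ 0 := by exact_mod_cast Real.pi_ne_zero
  -- The radial Helmholtz equation, written in the squared radius.
  have h5 : 6 * greenProfileDeriv ζ (‖x‖ ^ 2 + ε ^ 2) +
      4 * ((√(‖x‖ ^ 2 + ε ^ 2) : ℝ) : ℂ) ^ 2 * greenProfileDeriv₂ ζ (‖x‖ ^ 2 + ε ^ 2) =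
      -ζ ^ 2 * regGreen ζ ε x := by
    unfold regGreen greenProfile greenProfileDeriv greenProfileDeriv₂
    generalize ((√(‖x‖ ^ 2 + ε ^ 2) : ℝ) : ℂ) = s at *
    generalize Complex.exp (Complex.I * ζ * s) = e
    field_simp
    ring
  rw [h4] at h5
  unfold helmholtz
  rw [Fin.sum_univ_three] at h3 ⊢
  rw [h2, h2, h2]
  linear_combination -h5 + 4 * greenProfileDeriv₂ ζ (‖x‖ ^ 2 + ε ^ 2) * h3

/-! ### The limit `ε → 0` of the regularized kernel. -/

theorem norm_regGreen_le {ζ : ℂ} (hζ : 0 < ζ.im) (ε : ℝ) {x : E3} (hx : x ≠ 0) :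
    ‖regGreen ζ ε x‖ ≤ yukawa ζ.im x := by
  have hx' : 0 < ‖x‖ := norm_pos_iff.2 hx
  have hs : ‖x‖ ≤ √(‖x‖ ^ 2 + ε ^ 2) := Real.le_sqrt_of_sq_le (by nlinarith [sq_nonneg ε])
  unfold regGreen greenProfile yukawa
  rw [norm_div, Complex.norm_exp]
  have h1 : ‖4 * (Real.pi : ℂ) * ((√(‖x‖ ^ 2 + ε ^ 2) : ℝ) : ℂ)‖ =
      4 * Real.pi * √(‖x‖ ^ 2 + ε ^ 2) := by
    simp [abs_of_pos Real.pi_pos, abs_of_nonneg (Real.sqrt_nonneg _)]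
  rw [h1]
  have h2 : (Complex.I * ζ * ((√(‖x‖ ^ 2 + ε ^ 2) : ℝ) : ℂ)).re =
      -ζ.im * √(‖x‖ ^ 2 + ε ^ 2) := by simp
  rw [h2]
  have h3 : -ζ.im * √(‖x‖ ^ 2 + ε ^ 2) ≤ -ζ.im * ‖x‖ := by nlinarith
  gcongr

theorem regGreen_zero (ζ : ℂ) (x : E3) : regGreen ζ 0 x = greenKernel ζ x := by
  simp [regGreen, greenProfile, greenKernel]

theorem tendsto_regGreen (ζ : ℂ) {x : E3} (hx : x ≠ 0) :
    Tendsto (fun ε => regGreen ζ ε x) (𝓝[>] 0) (𝓝 (greenKernel ζ x)) := by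
  rw [← regGreen_zero]
  refine Tendsto.mono_left ?_ nhdsWithin_le_nhds
  have h := (hasDerivAt_greenProfile ζ (t := ‖x‖ ^ 2 + 0 ^ 2)
    (by have := norm_pos_iff.2 hx; positivity)).continuousAt
  have h2 : Tendsto (fun ε : ℝ => ‖x‖ ^ 2 + ε ^ 2) (𝓝 0) (𝓝 (‖x‖ ^ 2 + 0 ^ 2)) :=
    Continuous.tendsto (by fun_prop) 0
  exact h.tendsto.comp h2

theorem tendsto_integral_regGreen_mul {ζ : ℂ} (hζ : 0 < ζ.im) {φ : E3 → ℂ} (hφ : Continuous φ)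
    (hc : HasCompactSupport φ) :
    Tendsto (fun ε => ∫ x, regGreen ζ ε x * φ x) (𝓝[>] 0) (𝓝 (∫ x, greenKernel ζ x * φ x)) := by
  obtain ⟨C, hC⟩ := hφ.bounded_above_of_compact_support hc
  have hne : ∀ᵐ x : E3, x ≠ 0 := by simp [ae_iff]
  refine tendsto_integral_filter_of_dominated_convergence (fun x => yukawa ζ.im x * C) ?_ ?_
    ((integrable_yukawa hζ).mul_const C) ?_
  · filter_upwards [self_mem_nhdsWithin] with ε hε
    exact ((contDiff_regGreen ζ hε).continuous.mul hφ).aestronglyMeasurable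
  · filter_upwards with ε
    filter_upwards [hne] with x hx
    rw [norm_mul]
    exact mul_le_mul (norm_regGreen_le hζ ε hx) (hC x) (norm_nonneg _) (yukawa_nonneg _ _)
  · filter_upwards [hne] with x hx
    exact (tendsto_regGreen ζ hx).mul_const _

/-- This density is the limit of the rescaled defect `4ε²F''`; its total mass one is what produces
exactly `χ 0`. -/
theorem integral_three_div_sqrt_pow_five :
    ∫ y : E3, 3 / (4 * Real.pi * √(1 + ‖y‖ ^ 2) ^ 5) = 1 := by
  have hp : ∀ t : ℝ, 0 < 1 + t ^ 2 := fun t => by positivity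
  have h := integral_fun_norm_addHaar (volume : Measure E3)
    (f := fun t => 3 / (4 * Real.pi * √(1 + t ^ 2) ^ 5))
  rw [h, finrank_euclideanSpace, Fintype.card_fin]
  have hv : (volume : Measure E3).real (Metric.ball 0 1) = Real.pi * 4 / 3 := by
    rw [Measure.real, EuclideanSpace.volume_ball_fin_three]
    simp only [ENNReal.ofReal_one, one_pow, one_mul]
    exact ENNReal.toReal_ofReal (by positivity)
  -- An explicit antiderivative of the radial integrand, running from `0` to `1` on the half-line.
  have hd : ∀ t : ℝ, HasDerivAt (fun t => (t / √(1 + t ^ 2)) ^ 3)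
      (3 * t ^ 2 / √(1 + t ^ 2) ^ 5) t := fun t => by
    have h0 : √(1 + t ^ 2) ≠ 0 := (Real.sqrt_pos.2 (hp t)).ne'
    have hs := (((hasDerivAt_id t).fun_pow 2).const_add 1).sqrt (hp t).ne'
    refine (((hasDerivAt_id t).fun_div hs h0).fun_pow 3).congr_deriv ?_
    have h2 : √(1 + t ^ 2) ^ 2 = 1 + t ^ 2 := Real.sq_sqrt (hp t).le
    simp only [id]
    generalize √(1 + t ^ 2) = s at *
    push_cast
    field_simp
    linear_combination t ^ 2 * h2
  have hlim : Tendsto (fun t : ℝ => (t / √(1 + t ^ 2)) ^ 3) atTop (𝓝 1) := by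
    have h1 : Tendsto (fun t : ℝ => √(1 - (1 + t ^ 2)⁻¹)) atTop (𝓝 (√(1 - 0))) := by
      refine (Real.continuous_sqrt.tendsto _).comp (tendsto_const_nhds.sub ?_)
      exact (tendsto_atTop_add_const_left _ _ (tendsto_pow_atTop two_ne_zero)).inv_tendsto_atTop
    have h2 : Tendsto (fun t : ℝ => t / √(1 + t ^ 2)) atTop (𝓝 1) := by
      rw [sub_zero, Real.sqrt_one] at h1
      refine h1.congr' ?_
      filter_upwards [eventually_ge_atTop 0] with t ht
      rw [show 1 - (1 + t ^ 2)⁻¹ = t ^ 2 / (1 + t ^ 2) by field_simp [(hp t).ne']; ring,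
        Real.sqrt_div (sq_nonneg t), Real.sqrt_sq ht]
    simpa using h2.pow 3
  have hi : ∫ t in Set.Ioi (0 : ℝ), 3 * t ^ 2 / √(1 + t ^ 2) ^ 5 = 1 := by
    have := integral_Ioi_of_hasDerivAt_of_nonneg (a := 0) (hd 0).continuousAt.continuousWithinAt
      (fun t _ => hd t) (fun t _ => by positivity) hlim
    rw [this]; simp
  have hi2 : ∫ t in Set.Ioi (0 : ℝ), t ^ (3 - 1) • (3 / (4 * Real.pi * √(1 + t ^ 2) ^ 5)) =
      (4 * Real.pi)⁻¹ * ∫ t in Set.Ioi (0 : ℝ), 3 * t ^ 2 / √(1 + t ^ 2) ^ 5 := by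
    rw [← integral_const_mul]
    congr 1
    ext t
    have h0 : √(1 + t ^ 2) ≠ 0 := (Real.sqrt_pos.2 (hp t)).ne'
    simp only [smul_eq_mul, Nat.add_one_sub_one]
    field_simp
  rw [hi2, hi, hv]
  simp only [nsmul_eq_mul, smul_eq_mul]
  push_cast
  field_simp

theorem integrable_inv_sqrt_pow_five : Integrable (fun y : E3 => (√(1 + ‖y‖ ^ 2) ^ 5)⁻¹) := by
  have h := integrable_rpow_neg_one_add_norm_sq (E := E3) (μ := volume) (r := 5)
    (by rw [finrank_euclideanSpace, Fintype.card_fin]; norm_num)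
  refine h.congr (Eventually.of_forall fun y => ?_)
  have hp : 0 ≤ 1 + ‖y‖ ^ 2 := by positivity
  show (1 + ‖y‖ ^ 2) ^ (-5 / 2 : ℝ) = (√(1 + ‖y‖ ^ 2) ^ 5)⁻¹
  rw [Real.sqrt_eq_rpow, ← Real.rpow_mul_natCast hp, ← Real.rpow_neg hp]
  norm_num

/-- Exponential decay beats the quadratic, by `1 + x + x²/2 ≤ exp x` at `x = w Im ζ`. Uniformity in
`w` gives a dominating function independent of `ε`. -/
theorem norm_exp_mul_quadratic_le {ζ : ℂ} (hζ : 0 < ζ.im) {w : ℝ} (hw : 0 ≤ w) :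
    ‖Complex.exp (Complex.I * ζ * w) * (-ζ ^ 2 * w ^ 2 - 3 * Complex.I * ζ * w + 3)‖ ≤
      2 * ‖ζ‖ ^ 2 / ζ.im ^ 2 + 3 * ‖ζ‖ / ζ.im + 3 := by
  have hexp := Real.quadratic_le_exp_of_nonneg (mul_nonneg hζ.le hw)
  have he : ‖Complex.exp (Complex.I * ζ * w)‖ = (Real.exp (ζ.im * w))⁻¹ := by
    rw [Complex.norm_exp, ← Real.exp_neg]
    simp
  have hq : ‖-ζ ^ 2 * (w : ℂ) ^ 2 - 3 * Complex.I * ζ * w + 3‖ ≤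
      ‖ζ‖ ^ 2 * w ^ 2 + 3 * ‖ζ‖ * w + 3 := by
    refine (norm_add_le _ _).trans ?_
    refine add_le_add ((norm_sub_le _ _).trans ?_) (by simp)
    simp [abs_of_nonneg hw]
  rw [norm_mul, he, inv_mul_le_iff₀ (Real.exp_pos _)]
  refine hq.trans ?_
  have h1 : w ≤ Real.exp (ζ.im * w) / ζ.im := by
    rw [le_div_iff₀ hζ]; nlinarith [sq_nonneg (ζ.im * w)]
  have h2 : w ^ 2 ≤ 2 * Real.exp (ζ.im * w) / ζ.im ^ 2 := by
    rw [le_div_iff₀ (by positivity)]; nlinarith [mul_nonneg hζ.le hw]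
  have h3 : 1 ≤ Real.exp (ζ.im * w) := Real.one_le_exp (mul_nonneg hζ.le hw)
  calc ‖ζ‖ ^ 2 * w ^ 2 + 3 * ‖ζ‖ * w + 3
      ≤ ‖ζ‖ ^ 2 * (2 * Real.exp (ζ.im * w) / ζ.im ^ 2) +
        3 * ‖ζ‖ * (Real.exp (ζ.im * w) / ζ.im) + 3 * Real.exp (ζ.im * w) := by
        gcongr; linarith
    _ = _ := by ring

theorem scaled_helmholtz_regGreen (ζ : ℂ) {ε : ℝ} (hε : 0 < ε) (y : E3) :
    (ε : ℂ) ^ 3 * helmholtz (ζ ^ 2) (regGreen ζ ε) (ε • y) =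
      Complex.exp (Complex.I * ζ * (ε * √(1 + ‖y‖ ^ 2) : ℝ)) *
        (-ζ ^ 2 * (ε * √(1 + ‖y‖ ^ 2) : ℝ) ^ 2 -
          3 * Complex.I * ζ * (ε * √(1 + ‖y‖ ^ 2) : ℝ) + 3) *
        ((4 * Real.pi)⁻¹ * (√(1 + ‖y‖ ^ 2) ^ 5)⁻¹ : ℝ) := by
  rw [helmholtz_regGreen ζ hε]
  have h1 : √(‖ε • y‖ ^ 2 + ε ^ 2) = ε * √(1 + ‖y‖ ^ 2) := by
    rw [norm_smul, Real.norm_of_nonneg hε.le,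
      show (ε * ‖y‖) ^ 2 + ε ^ 2 = ε ^ 2 * (1 + ‖y‖ ^ 2) by ring, Real.sqrt_mul (sq_nonneg ε),
      Real.sqrt_sq hε.le]
  unfold greenProfileDeriv₂
  rw [h1]
  have h0 : ((√(1 + ‖y‖ ^ 2) : ℝ) : ℂ) ≠ 0 := by
    exact_mod_cast (Real.sqrt_pos.2 (by positivity : 0 < 1 + ‖y‖ ^ 2)).ne'
  have hε0 : (ε : ℂ) ≠ 0 := by exact_mod_cast hε.ne'
  have hpi : (Real.pi : ℂ) ≠ 0 := by exact_mod_cast Real.pi_ne_zero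
  push_cast
  field_simp
  ring

/-- The substitution `x = ε y` exhibits the defect as an approximate identity. -/
theorem tendsto_integral_helmholtz_regGreen {ζ : ℂ} (hζ : 0 < ζ.im) {χ : E3 → ℂ}
    (hχ : Continuous χ) (hc : HasCompactSupport χ) :
    Tendsto (fun ε => ∫ x, helmholtz (ζ ^ 2) (regGreen ζ ε) x * χ x) (𝓝[>] 0) (𝓝 (χ 0)) := by
  obtain ⟨C, hC⟩ := hχ.bounded_above_of_compact_support hc
  set M := 2 * ‖ζ‖ ^ 2 / ζ.im ^ 2 + 3 * ‖ζ‖ / ζ.im + 3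
  have hM : 0 ≤ M := by positivity
  -- The integrand after `x = ε y`, with the powers of `ε` cancelled so that it is continuous up to
  -- `ε = 0`.
  let P : ℝ → E3 → ℂ := fun ε y =>
    Complex.exp (Complex.I * ζ * (ε * √(1 + ‖y‖ ^ 2) : ℝ)) *
        (-ζ ^ 2 * (ε * √(1 + ‖y‖ ^ 2) : ℝ) ^ 2 -
          3 * Complex.I * ζ * (ε * √(1 + ‖y‖ ^ 2) : ℝ) + 3) *
        ((4 * Real.pi)⁻¹ * (√(1 + ‖y‖ ^ 2) ^ 5)⁻¹ : ℝ) * χ (ε • y)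
  have hs0 : ∀ y : E3, √(1 + ‖y‖ ^ 2) ^ 5 ≠ 0 := fun y =>
    pow_ne_zero _ (Real.sqrt_pos.2 (by positivity)).ne'
  have hcont : ∀ ε, Continuous (P ε) := fun ε => by
    have h5 : Continuous fun y : E3 => (√(1 + ‖y‖ ^ 2) ^ 5)⁻¹ :=
      Continuous.inv₀ (by fun_prop) hs0
    fun_prop
  have hcont' : ∀ y, Continuous fun ε => P ε y := fun y => by
    fun_prop
  have hlim : Tendsto (fun ε => ∫ y, P ε y) (𝓝[>] 0) (𝓝 (∫ y, P 0 y)) := by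
    refine tendsto_integral_filter_of_dominated_convergence
      (fun y => M * ((4 * Real.pi)⁻¹ * (√(1 + ‖y‖ ^ 2) ^ 5)⁻¹) * C) ?_ ?_
      (((integrable_inv_sqrt_pow_five.const_mul _).const_mul M).mul_const C) ?_
    · exact Eventually.of_forall fun ε => (hcont ε).aestronglyMeasurable
    · filter_upwards [self_mem_nhdsWithin] with ε hε
      filter_upwards with y
      have hε' : (0 : ℝ) < ε := hε
      simp only [P]
      rw [norm_mul, norm_mul]
      have h1 := norm_exp_mul_quadratic_le hζ (w := ε * √(1 + ‖y‖ ^ 2)) (by positivity)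
      refine mul_le_mul (mul_le_mul h1 ?_ (norm_nonneg _) hM) (hC _) (norm_nonneg _)
        (by positivity)
      rw [Complex.norm_real, Real.norm_of_nonneg (by positivity)]
    · filter_upwards with y
      exact ((hcont' y).tendsto 0).mono_left nhdsWithin_le_nhds
  have hP0 : ∫ y, P 0 y = χ 0 := by
    have : ∀ y, P 0 y = ((3 / (4 * Real.pi * √(1 + ‖y‖ ^ 2) ^ 5) : ℝ) : ℂ) * χ 0 := fun y => by
      simp only [P, zero_mul, Complex.ofReal_zero, mul_zero, Complex.exp_zero, zero_smul]
      have := hs0 y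
      push_cast
      field_simp
      ring
    simp_rw [this]
    rw [integral_mul_const, integral_complex_ofReal, integral_three_div_sqrt_pow_five]
    simp
  rw [hP0] at hlim
  refine hlim.congr' ?_
  filter_upwards [self_mem_nhdsWithin] with ε hε
  have hε' : (0 : ℝ) < ε := hε
  have h := Measure.integral_comp_smul (volume : Measure E3)
    (fun x => helmholtz (ζ ^ 2) (regGreen ζ ε) x * χ x) ε
  have h2 : ∀ y, P ε y = (ε : ℂ) ^ 3 * (helmholtz (ζ ^ 2) (regGreen ζ ε) (ε • y) * χ (ε • y)) :=
    fun y => by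
      rw [← mul_assoc, scaled_helmholtz_regGreen ζ hε']
  simp_rw [h2]
  rw [integral_const_mul, h, finrank_euclideanSpace, Fintype.card_fin,
    abs_of_pos (by positivity), Complex.real_smul]
  have hε0 : (ε : ℂ) ≠ 0 := by exact_mod_cast hε'.ne'
  push_cast
  field_simp

/-- `greenKernel ζ` is a fundamental solution of `-Δ - ζ²`. -/
theorem integral_greenKernel_mul_helmholtz {ζ : ℂ} (hζ : 0 < ζ.im) {χ : E3 → ℂ}
    (hχ : ContDiff ℝ ∞ χ) (hc : HasCompactSupport χ) :
    ∫ x, greenKernel ζ x * helmholtz (ζ ^ 2) χ x = χ 0 := by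
  refine tendsto_nhds_unique (tendsto_integral_regGreen_mul hζ
    (continuous_helmholtz _ hχ) (hasCompactSupport_helmholtz _ hc)) ?_
  refine (tendsto_integral_helmholtz_regGreen hζ hχ.continuous hc).congr' ?_
  filter_upwards [self_mem_nhdsWithin] with ε hε
  exact (integral_mul_helmholtz _ (contDiff_regGreen ζ hε) hχ hc).symm

/-! ### Exponentially weighted integrability -/

theorem integrable_exp_neg_norm {c : ℝ} (hc : 0 < c) :
    Integrable (fun x : E3 => Real.exp (-c * ‖x‖)) := by
  refine (integrable_fun_norm_addHaar (volume : Measure E3)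
    (f := fun t => Real.exp (-c * t))).2 ?_
  have := integrableOn_rpow_mul_exp_neg_mul_rpow (s := 2) (p := 1) (b := c)
    (by norm_num) one_pos hc
  refine this.congr_fun (fun t _ => ?_) measurableSet_Ioi
  simp [finrank_euclideanSpace]

/-- `g` is integrable against every exponentially decaying weight. -/
def ExpIntegrable (g : E3 → ℂ) : Prop :=
  ∀ c : ℝ, 0 < c → Integrable (fun x => Real.exp (-c * ‖x‖) • g x)

namespace ExpIntegrable

variable {g h : E3 → ℂ}

theorem aestronglyMeasurable (hg : ExpIntegrable g) : AEStronglyMeasurable g volume := by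
  have h1 := (hg 1 one_pos).aestronglyMeasurable
  have h2 : AEStronglyMeasurable (fun x : E3 => Real.exp (1 * ‖x‖)) volume :=
    (by fun_prop : Continuous fun x : E3 => Real.exp (1 * ‖x‖)).aestronglyMeasurable
  refine (h2.smul h1).congr (Eventually.of_forall fun x => ?_)
  simp only [Pi.smul_apply']
  rw [smul_smul, ← Real.exp_add]
  simp

/-- Small rates are the strong conditions, so they imply the rest. This matters because convolution
with `G` preserves the weight only for rates below `Im ζ`. -/
theorem of_le_of_lt {c₀ : ℝ} (hc₀ : 0 < c₀) (hg : ∀ c : ℝ, 0 < c → c < c₀ →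
    Integrable (fun x => Real.exp (-c * ‖x‖) • g x)) : ExpIntegrable g := by
  intro c hc
  have h1 := hg (min c (c₀ / 2)) (by positivity) ((min_le_right _ _).trans_lt (by linarith))
  set d := min c (c₀ / 2)
  have h2 : AEStronglyMeasurable (fun x : E3 => Real.exp (-(c - d) * ‖x‖)) volume :=
    (by fun_prop : Continuous fun x : E3 => Real.exp (-(c - d) * ‖x‖)).aestronglyMeasurable
  refine (h1.bdd_smul 1 h2 (Eventually.of_forall fun x => ?_)).congr
    (Eventually.of_forall fun x => ?_)
  · rw [Real.norm_of_nonneg (Real.exp_nonneg _), Real.exp_le_one_iff]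
    have : d ≤ c := min_le_left _ _
    nlinarith [norm_nonneg x]
  · simp only [Pi.smul_apply']
    rw [smul_smul, ← Real.exp_add]
    ring_nf

theorem add (hg : ExpIntegrable g) (hh : ExpIntegrable h) :
    ExpIntegrable (fun x => g x + h x) := fun c hc =>
  ((hg c hc).add (hh c hc)).congr (Eventually.of_forall fun x => by simp)

theorem const_mul (z : ℂ) (hg : ExpIntegrable g) : ExpIntegrable (fun x => z * g x) :=
  fun c hc => ((hg c hc).const_mul z).congr (Eventually.of_forall fun x => by
    simp only [Complex.real_smul]; ring)

theorem neg (hg : ExpIntegrable g) : ExpIntegrable (fun x => -g x) := by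
  simpa using hg.const_mul (-1)

theorem sub (hg : ExpIntegrable g) (hh : ExpIntegrable h) :
    ExpIntegrable (fun x => g x - h x) := by
  simpa [sub_eq_add_neg] using hg.add hh.neg

theorem congr (hg : ExpIntegrable g) (hgh : g =ᵐ[volume] h) : ExpIntegrable h := fun c hc =>
  (hg c hc).congr (by filter_upwards [hgh] with x hx; rw [hx])

theorem integrable_mul (hg : ExpIntegrable g) {f : E3 → ℂ} (hf : AEStronglyMeasurable f volume)
    {c C : ℝ} (hc : 0 < c) (hfC : ∀ x, ‖f x‖ ≤ C * Real.exp (-c * ‖x‖)) :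
    Integrable (fun x => g x * f x) := by
  have h2 : AEStronglyMeasurable (fun x : E3 => Real.exp (c * ‖x‖)) volume :=
    (by fun_prop : Continuous fun x : E3 => Real.exp (c * ‖x‖)).aestronglyMeasurable
  refine ((hg c hc).bdd_mul (c := C) (h2.smul hf) (Eventually.of_forall fun x => ?_)).congr
    (Eventually.of_forall fun x => ?_)
  · rw [Pi.smul_apply', norm_smul, Real.norm_of_nonneg (Real.exp_nonneg _), mul_comm]
    refine (mul_le_mul_of_nonneg_right (hfC x) (Real.exp_nonneg _)).trans_eq ?_
    rw [mul_assoc, ← Real.exp_add]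
    simp
  · simp only [Pi.smul_apply', Complex.real_smul]
    have : (Real.exp (c * ‖x‖) : ℂ) * (Real.exp (-c * ‖x‖) : ℂ) = 1 := by
      rw [← Complex.ofReal_mul, ← Real.exp_add]
      simp
    linear_combination (f x * g x) * this

theorem locallyIntegrable (hg : ExpIntegrable g) : LocallyIntegrable g volume := by
  have h2 : Continuous (fun x : E3 => Real.exp (1 * ‖x‖)) := by fun_prop
  rw [locallyIntegrable_iff]
  intro K hK
  refine ((hg 1 one_pos).integrableOn.continuousOn_smul h2.continuousOn hK).congr
    (Eventually.of_forall fun x => ?_)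
  simp only
  rw [smul_smul, ← Real.exp_add]
  simp

end ExpIntegrable

theorem exists_norm_le_exp {φ : E3 → ℂ} (hφ : Continuous φ) (hc : HasCompactSupport φ) (c : ℝ) :
    ∃ C, 0 ≤ C ∧ ∀ x, ‖φ x‖ ≤ C * Real.exp (-c * ‖x‖) := by
  have h2 : Continuous (fun x : E3 => Real.exp (c * ‖x‖) • φ x) := by fun_prop
  obtain ⟨C, hC⟩ := h2.bounded_above_of_compact_support
    (hc.smul_left (f := fun x : E3 => Real.exp (c * ‖x‖)))
  refine ⟨C, (norm_nonneg _).trans (hC 0), fun x => ?_⟩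
  have := hC x
  rw [norm_smul, Real.norm_of_nonneg (Real.exp_nonneg _)] at this
  rw [neg_mul, Real.exp_neg, ← div_eq_mul_inv, le_div_iff₀ (Real.exp_pos _)]
  linarith

theorem exp_neg_norm_le (c : ℝ) (hc : 0 ≤ c) (x y : E3) :
    Real.exp (-c * ‖x‖) ≤ Real.exp (-c * ‖y‖) * Real.exp (c * ‖x - y‖) := by
  rw [← Real.exp_add, Real.exp_le_exp]
  have := norm_le_norm_add_norm_sub x y
  nlinarith

/-! ### Convolution with the Green kernel -/

/-- The convolution of the Green kernel with `g`. -/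
noncomputable def greenConv (ζ : ℂ) (g : E3 → ℂ) (x : E3) : ℂ :=
  ∫ y, greenKernel ζ (x - y) * g y

theorem lintegral_yukawa_sub {κ : ℝ} (y : E3) :
    ∫⁻ x, ENNReal.ofReal (yukawa κ (x - y)) = ∫⁻ x, ENNReal.ofReal (yukawa κ x) :=
  lintegral_sub_right_eq_self (fun x => ENNReal.ofReal (yukawa κ x)) y

theorem lintegral_exp_mul_yukawa_le {κ c : ℝ} (hc : 0 ≤ c) (y : E3) :
    ∫⁻ x, ENNReal.ofReal (Real.exp (-c * ‖x‖) * yukawa κ (x - y)) ≤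
      ENNReal.ofReal (Real.exp (-c * ‖y‖)) * ∫⁻ x, ENNReal.ofReal (yukawa (κ - c) x) := by
  have hm : Measurable fun x => ENNReal.ofReal (yukawa (κ - c) (x - y)) :=
    ((measurable_yukawa _).comp (measurable_id.sub_const y)).ennreal_ofReal
  rw [← lintegral_yukawa_sub y, ← lintegral_const_mul _ hm]
  refine lintegral_mono fun x => ?_
  rw [← ENNReal.ofReal_mul (Real.exp_nonneg _), ← exp_mul_yukawa c, ← mul_assoc]
  exact ENNReal.ofReal_le_ofReal
    (mul_le_mul_of_nonneg_right (exp_neg_norm_le c hc x y) (yukawa_nonneg _ _))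

theorem lintegral_yukawa_lt_top {κ : ℝ} (hκ : 0 < κ) :
    ∫⁻ x, ENNReal.ofReal (yukawa κ x) < ⊤ :=
  (integrable_yukawa hκ).lintegral_lt_top

theorem enorm_exp_smul (c : ℝ) (g : E3 → ℂ) (x : E3) :
    ‖Real.exp (-c * ‖x‖) • g x‖ₑ = ENNReal.ofReal (Real.exp (-c * ‖x‖)) * ‖g x‖ₑ := by
  rw [enorm_smul, Real.enorm_of_nonneg (Real.exp_nonneg _)]

/-- A weighted Young inequality: integrating in `x` first, the weight passes to `y` and the kernel
loses decay `c`. -/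
theorem lintegral_lintegral_green_le {ζ : ℂ} {c : ℝ} (hc : 0 < c) {g : E3 → ℂ}
    (hg : AEStronglyMeasurable g volume) :
    ∫⁻ y, ∫⁻ x, ‖Real.exp (-c * ‖x‖) • (greenKernel ζ (x - y) * g y)‖ₑ ≤
      (∫⁻ x, ENNReal.ofReal (yukawa (ζ.im - c) x)) *
        ∫⁻ y, ‖Real.exp (-c * ‖y‖) • g y‖ₑ := by
  have hm : AEMeasurable (fun y => ‖Real.exp (-c * ‖y‖) • g y‖ₑ) volume := by
    refine AEStronglyMeasurable.enorm ?_
    exact (by fun_prop : Continuous fun y : E3 =>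
      Real.exp (-c * ‖y‖)).aestronglyMeasurable.smul hg
  rw [← lintegral_const_mul'' _ hm]
  refine lintegral_mono fun y => ?_
  have h1 : ∀ x, ‖Real.exp (-c * ‖x‖) • (greenKernel ζ (x - y) * g y)‖ₑ =
      ENNReal.ofReal (Real.exp (-c * ‖x‖) * yukawa ζ.im (x - y)) * ‖g y‖ₑ := fun x => by
    rw [enorm_smul, enorm_mul, ← ofReal_norm (greenKernel ζ (x - y)), norm_greenKernel,
      Real.enorm_of_nonneg (Real.exp_nonneg _), ENNReal.ofReal_mul (Real.exp_nonneg _), mul_assoc]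
  simp_rw [h1]
  have hmeas : Measurable fun x : E3 =>
      ENNReal.ofReal (Real.exp (-c * ‖x‖) * yukawa ζ.im (x - y)) := by
    have := (measurable_yukawa ζ.im).comp (measurable_id.sub_const y : Measurable fun x : E3 => x - y)
    exact ((by fun_prop : Measurable fun x : E3 => Real.exp (-c * ‖x‖)).mul this).ennreal_ofReal
  rw [lintegral_mul_const _ hmeas, enorm_exp_smul, ← mul_assoc]
  gcongr
  rw [mul_comm]
  exact lintegral_exp_mul_yukawa_le hc.le y

theorem aestronglyMeasurable_green_prod {ζ : ℂ} (c : ℝ) {g : E3 → ℂ}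
    (hg : AEStronglyMeasurable g volume) :
    AEStronglyMeasurable (fun q : E3 × E3 => Real.exp (-c * ‖q.1‖) •
      (greenKernel ζ (q.1 - q.2) * g q.2)) (volume.prod volume) := by
  have h1 : AEStronglyMeasurable (fun q : E3 × E3 => Real.exp (-c * ‖q.1‖))
      (volume.prod volume) :=
    (by fun_prop : Continuous fun q : E3 × E3 => Real.exp (-c * ‖q.1‖)).aestronglyMeasurable
  have h2 : AEStronglyMeasurable (fun q : E3 × E3 => greenKernel ζ (q.1 - q.2))
      (volume.prod volume) :=
    ((measurable_greenKernel ζ).comp (measurable_fst.sub measurable_snd)).aestronglyMeasurable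
  exact h1.smul (h2.mul (hg.comp_snd))

theorem integrable_green_prod {ζ : ℂ} {c : ℝ} (hc : 0 < c) (hcζ : c < ζ.im) {g : E3 → ℂ}
    (hg : ExpIntegrable g) :
    Integrable (fun q : E3 × E3 => Real.exp (-c * ‖q.1‖) • (greenKernel ζ (q.1 - q.2) * g q.2))
      (volume.prod volume) := by
  have hm := aestronglyMeasurable_green_prod (ζ := ζ) c hg.aestronglyMeasurable
  refine ⟨hm, ?_⟩
  rw [HasFiniteIntegral, lintegral_prod_symm _ hm.enorm]
  refine (lintegral_lintegral_green_le hc hg.aestronglyMeasurable).trans_lt ?_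
  exact ENNReal.mul_lt_top (lintegral_yukawa_lt_top (by linarith)) (hg c hc).2

theorem expIntegrable_greenConv {ζ : ℂ} (hζ : 0 < ζ.im) {g : E3 → ℂ} (hg : ExpIntegrable g) :
    ExpIntegrable (greenConv ζ g) := by
  refine ExpIntegrable.of_le_of_lt hζ fun c hc hcζ => ?_
  refine (integrable_green_prod hc hcζ hg).integral_prod_left.congr
    (Eventually.of_forall fun x => ?_)
  simp only [greenConv]
  rw [integral_smul]

theorem lintegral_exp_smul_greenConv_le {ζ : ℂ} {c : ℝ} (hc : 0 < c) {g : E3 → ℂ}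
    (hg : AEStronglyMeasurable g volume) :
    ∫⁻ x, ‖Real.exp (-c * ‖x‖) • greenConv ζ g x‖ₑ ≤
      (∫⁻ x, ENNReal.ofReal (yukawa (ζ.im - c) x)) * ∫⁻ y, ‖Real.exp (-c * ‖y‖) • g y‖ₑ := by
  refine le_trans ?_ (lintegral_lintegral_green_le hc hg)
  have hm := (aestronglyMeasurable_green_prod (ζ := ζ) c hg).enorm
  rw [← lintegral_prod_symm (fun q : E3 × E3 => ‖Real.exp (-c * ‖q.1‖) •
    (greenKernel ζ (q.1 - q.2) * g q.2)‖ₑ) hm, lintegral_prod _ hm]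
  refine lintegral_mono fun x => ?_
  simp only [greenConv]
  rw [← integral_smul]
  exact enorm_integral_le_lintegral_enorm _

theorem greenConv_congr {ζ : ℂ} {g h : E3 → ℂ} (hgh : g =ᵐ[volume] h) :
    greenConv ζ g = greenConv ζ h := by
  ext x
  refine integral_congr_ae ?_
  filter_upwards [hgh] with y hy
  rw [hy]

theorem ExpIntegrable.ae_integrable_green {ζ : ℂ} (hζ : 0 < ζ.im) {g : E3 → ℂ}
    (hg : ExpIntegrable g) : ∀ᵐ x, Integrable (fun y => greenKernel ζ (x - y) * g y) := by
  filter_upwards [(integrable_green_prod (half_pos hζ) (half_lt_self hζ) hg).prod_right_ae]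
    with x hx
  have := hx.smul (Real.exp (ζ.im / 2 * ‖x‖))
  refine this.congr (Eventually.of_forall fun y => ?_)
  simp only [Pi.smul_apply]
  rw [smul_smul, ← Real.exp_add]
  simp

theorem greenConv_sub_ae {ζ : ℂ} (hζ : 0 < ζ.im) {g h : E3 → ℂ} (hg : ExpIntegrable g)
    (hh : ExpIntegrable h) :
    greenConv ζ (fun x => g x - h x) =ᵐ[volume] fun x => greenConv ζ g x - greenConv ζ h x := by
  filter_upwards [hg.ae_integrable_green hζ, hh.ae_integrable_green hζ] with x h1 h2
  simp only [greenConv]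
  rw [← integral_sub h1 h2]
  simp only [mul_sub]

/-- Symmetry of convolution with the Green kernel. -/
theorem integral_mul_greenConv {ζ : ℂ} (hζ : 0 < ζ.im) {g φ : E3 → ℂ} (hg : ExpIntegrable g)
    (hφ : Continuous φ) (hc : HasCompactSupport φ) :
    ∫ x, g x * greenConv ζ φ x = ∫ x, greenConv ζ g x * φ x := by
  have hζ2 := half_pos hζ
  obtain ⟨C, hC0, hC⟩ := exists_norm_le_exp hφ hc (ζ.im / 2)
  have hb : AEStronglyMeasurable (fun q : E3 × E3 => Real.exp (ζ.im / 2 * ‖q.1‖) • φ q.1)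
      (volume.prod volume) :=
    (by fun_prop : Continuous fun q : E3 × E3 =>
      Real.exp (ζ.im / 2 * ‖q.1‖) • φ q.1).aestronglyMeasurable
  have hint : Integrable (fun q : E3 × E3 => φ q.1 * (greenKernel ζ (q.1 - q.2) * g q.2))
      (volume.prod volume) := by
    refine ((integrable_green_prod hζ2 (half_lt_self hζ) hg).bdd_mul (c := C) hb
      (Eventually.of_forall fun q => ?_)).congr (Eventually.of_forall fun q => ?_)
    · rw [norm_smul, Real.norm_of_nonneg (Real.exp_nonneg _), mul_comm]
      refine (mul_le_mul_of_nonneg_right (hC q.1) (Real.exp_nonneg _)).trans_eq ?_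
      rw [mul_assoc, ← Real.exp_add]
      simp
    · simp only [Complex.real_smul]
      have : (Real.exp (ζ.im / 2 * ‖q.1‖) : ℂ) * (Real.exp (-(ζ.im / 2) * ‖q.1‖) : ℂ) = 1 := by
        rw [← Complex.ofReal_mul, ← Real.exp_add]
        simp
      linear_combination (φ q.1 * (greenKernel ζ (q.1 - q.2) * g q.2)) * this
  have h := integral_integral_swap (f := fun x y => φ x * (greenKernel ζ (x - y) * g y)) hint
  simp only [greenConv]
  calc ∫ x, g x * ∫ y, greenKernel ζ (x - y) * φ y
      = ∫ y, ∫ x, φ x * (greenKernel ζ (x - y) * g y) := by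
        congr 1; ext y
        rw [← integral_const_mul]
        congr 1; ext x
        rw [← greenKernel_neg, neg_sub]
        ring
    _ = ∫ x, ∫ y, φ x * (greenKernel ζ (x - y) * g y) := h.symm
    _ = _ := by
        congr 1; ext x
        rw [integral_const_mul, mul_comm]

/-! ### Potentials of test functions -/

theorem greenConv_eq_convolution (ζ : ℂ) (φ : E3 → ℂ) :
    greenConv ζ φ = convolution (greenKernel ζ) φ (ContinuousLinearMap.mul ℝ ℂ) volume := by
  ext x
  rw [convolution_eq_swap]
  rfl

theorem greenConv_eq_integral (ζ : ℂ) (φ : E3 → ℂ) (x : E3) :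
    greenConv ζ φ x = ∫ y, greenKernel ζ y * φ (x - y) := by
  rw [greenConv_eq_convolution]
  rfl

theorem contDiff_greenConv {ζ : ℂ} (hζ : 0 < ζ.im) {φ : E3 → ℂ} (hφ : ContDiff ℝ ∞ φ)
    (hc : HasCompactSupport φ) : ContDiff ℝ ∞ (greenConv ζ φ) := by
  rw [greenConv_eq_convolution]
  exact hc.contDiff_convolution_right (n := ⊤) _ (integrable_greenKernel hζ).locallyIntegrable hφ

theorem partialDeriv_greenConv {ζ : ℂ} (hζ : 0 < ζ.im) (i : Fin 3) {φ : E3 → ℂ}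
    (hφ : ContDiff ℝ ∞ φ) (hc : HasCompactSupport φ) :
    partialDeriv i (greenConv ζ φ) = greenConv ζ (partialDeriv i φ) := by
  ext x
  have hk := (integrable_greenKernel hζ).locallyIntegrable
  unfold partialDeriv
  rw [greenConv_eq_convolution, greenConv_eq_convolution,
    (hc.hasFDerivAt_convolution_right (ContinuousLinearMap.mul ℝ ℂ) hk
      (hφ.of_le (by simp)) x).fderiv]
  exact convolution_precompR_apply (L := ContinuousLinearMap.mul ℝ ℂ) hk (hc.fderiv (𝕜 := ℝ))
    (hφ.continuous_fderiv (by simp)) x _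

theorem partialDeriv_comp_const_sub (i : Fin 3) {φ : E3 → ℂ} (hφ : ContDiff ℝ ∞ φ) (x : E3) :
    partialDeriv i (fun y => φ (x - y)) = fun y => -partialDeriv i φ (x - y) := by
  ext y
  have h1 := ((hφ.differentiable (by simp) (x - y)).hasFDerivAt).comp y
    ((hasFDerivAt_id y).const_sub x)
  have h2 : HasFDerivAt (fun y => φ (x - y)) ((fderiv ℝ φ (x - y)).comp
    (-ContinuousLinearMap.id ℝ E3)) y := h1
  unfold partialDeriv
  rw [h2.fderiv]
  simp

theorem partialDeriv_neg (i : Fin 3) (φ : E3 → ℂ) :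
    partialDeriv i (fun y => -φ y) = fun y => -partialDeriv i φ y := by
  ext y
  unfold partialDeriv
  rw [fderiv_fun_neg]
  simp

/-- All derivatives can be put on `φ`; then the fundamental solution is tested against `y ↦ φ (x -
y)`. The reflection signs cancel in second order. -/
theorem helmholtz_greenConv {ζ : ℂ} (hζ : 0 < ζ.im) {φ : E3 → ℂ} (hφ : ContDiff ℝ ∞ φ)
    (hc : HasCompactSupport φ) (x : E3) : helmholtz (ζ ^ 2) (greenConv ζ φ) x = φ x := by
  have hs : ContDiff ℝ ∞ (fun y => φ (x - y)) := hφ.comp (contDiff_const.sub contDiff_id)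
  have hsc : HasCompactSupport (fun y => φ (x - y)) :=
    hc.comp_homeomorph (Homeomorph.subLeft x)
  have h := integral_greenKernel_mul_helmholtz hζ hs hsc
  rw [sub_zero] at h
  have h2 : ∀ i, partialDeriv i (partialDeriv i (fun y => φ (x - y))) =
      fun y => partialDeriv i (partialDeriv i φ) (x - y) := fun i => by
    rw [partialDeriv_comp_const_sub i hφ, partialDeriv_neg,
      partialDeriv_comp_const_sub i (contDiff_partialDeriv i hφ)]
    simp
  have hint : ∀ ψ : E3 → ℂ, Continuous ψ → HasCompactSupport ψ →
      Integrable (fun y => greenKernel ζ y * ψ (x - y)) := fun ψ h1 h2 => by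
    obtain ⟨C, hC⟩ := h1.bounded_above_of_compact_support h2
    exact (integrable_greenKernel hζ).mul_bdd (c := C)
      (h1.comp (continuous_const.sub continuous_id)).aestronglyMeasurable
      (Eventually.of_forall fun y => hC _)
  have j1 : ∀ i, Integrable (fun y => greenKernel ζ y * partialDeriv i (partialDeriv i φ) (x - y)) :=
    fun i => hint _ (partialDeriv_continuous i (contDiff_partialDeriv i hφ))
      (partialDeriv_hasCompactSupport i (partialDeriv_hasCompactSupport i hc))
  have j2 := (hint _ hφ.continuous hc).const_mul (ζ ^ 2)
  have j3 := (integrable_finsetSum Finset.univ fun i _ => j1 i).fun_neg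
  rw [← h]
  unfold helmholtz
  simp_rw [h2]
  calc _ = ∫ y, (-(∑ i, greenKernel ζ y * partialDeriv i (partialDeriv i φ) (x - y)) -
          ζ ^ 2 * (greenKernel ζ y * φ (x - y))) := by
        rw [integral_sub j3 j2, integral_neg, integral_finsetSum _ fun i _ => j1 i,
          integral_const_mul, greenConv_eq_integral]
        congr 2
        refine Finset.sum_congr rfl fun i _ => ?_
        rw [partialDeriv_greenConv hζ i hφ hc, partialDeriv_greenConv hζ i
          (contDiff_partialDeriv i hφ) (partialDeriv_hasCompactSupport i hc),
          greenConv_eq_integral]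
    _ = _ := by
        congr 1; ext y
        rw [mul_sub, mul_neg, Finset.mul_sum]
        ring

/-- Potentials of test functions inherit any decay rate below `Im ζ`, so they can be paired with
`ExpIntegrable` functions. -/
theorem norm_greenConv_le {ζ : ℂ} {φ : E3 → ℂ} {c C : ℝ} (hc : 0 ≤ c) (hcζ : c < ζ.im)
    (hφ : ∀ x, ‖φ x‖ ≤ C * Real.exp (-c * ‖x‖)) (x : E3) :
    ‖greenConv ζ φ x‖ ≤ (C * ∫ y, yukawa (ζ.im - c) y) * Real.exp (-c * ‖x‖) := by
  have hC : 0 ≤ C := by simpa using (norm_nonneg _).trans (hφ 0)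
  rw [greenConv_eq_integral]
  have hi := (integrable_yukawa (κ := ζ.im - c) (by linarith)).const_mul
    (C * Real.exp (-c * ‖x‖))
  refine (norm_integral_le_of_norm_le hi (Eventually.of_forall fun y => ?_)).trans_eq ?_
  · rw [norm_mul, norm_greenKernel, ← exp_mul_yukawa c]
    have h1 := exp_neg_norm_le c hc (x - y) x
    rw [show x - y - x = -y by abel, norm_neg] at h1
    have h2 : ‖φ (x - y)‖ ≤ C * (Real.exp (-c * ‖x‖) * Real.exp (c * ‖y‖)) :=
      (hφ _).trans (mul_le_mul_of_nonneg_left h1 hC)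
    calc yukawa ζ.im y * ‖φ (x - y)‖
        ≤ yukawa ζ.im y * (C * (Real.exp (-c * ‖x‖) * Real.exp (c * ‖y‖))) :=
          mul_le_mul_of_nonneg_left h2 (yukawa_nonneg _ _)
      _ = _ := by ring
  · rw [integral_const_mul]
    ring

/-! ### Very weak solutions of the Helmholtz equation -/

/-- `-Δu - zu = g` in the sense of distributions. -/
def IsVeryWeakSol (z : ℂ) (u g : E3 → ℂ) : Prop :=
  ∀ χ : E3 → ℂ, ContDiff ℝ ∞ χ → HasCompactSupport χ →
    ∫ x, u x * helmholtz z χ x = ∫ x, g x * χ x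

/-! ### Cutoffs at infinity and uniqueness of solutions. -/

theorem partialDeriv_comp_smul (i : Fin 3) (η : E3 → ℂ) (t : ℝ) :
    partialDeriv i (fun x => η (t • x)) = fun x => (t : ℂ) * partialDeriv i η (t • x) := by
  ext x
  unfold partialDeriv
  have := fderiv_comp_smul (𝕜 := ℝ) (f := η) (x := x) t
  rw [this]
  simp

theorem partialDeriv_const_mul (i : Fin 3) (c : ℂ) {η : E3 → ℂ} (hη : ContDiff ℝ ∞ η) :
    partialDeriv i (fun x => c * η x) = fun x => c * partialDeriv i η x := by
  ext x
  unfold partialDeriv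
  rw [fderiv_const_mul (hη.differentiable (by simp) x)]
  simp

theorem partialDeriv_partialDeriv_mul (i : Fin 3) {η ψ : E3 → ℂ} (hη : ContDiff ℝ ∞ η)
    (hψ : ContDiff ℝ ∞ ψ) (x : E3) :
    partialDeriv i (partialDeriv i fun y => η y * ψ y) x =
      partialDeriv i (partialDeriv i η) x * ψ x + 2 * (partialDeriv i η x * partialDeriv i ψ x) +
        η x * partialDeriv i (partialDeriv i ψ) x := by
  have d : ∀ {f : E3 → ℂ}, ContDiff ℝ ∞ f → ∀ y, DifferentiableAt ℝ f y := fun h y =>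
    h.differentiable (by simp) y
  have hη' := contDiff_partialDeriv i hη
  have hψ' := contDiff_partialDeriv i hψ
  have h1 : (partialDeriv i fun y => η y * ψ y) =
      fun y => partialDeriv i η y * ψ y + η y * partialDeriv i ψ y := by
    ext y
    exact partialDeriv_mul i (d hη y) (d hψ y)
  have h2 : partialDeriv i (fun y => partialDeriv i η y * ψ y + η y * partialDeriv i ψ y) x =
      partialDeriv i (fun y => partialDeriv i η y * ψ y) x +
        partialDeriv i (fun y => η y * partialDeriv i ψ y) x := by
    unfold partialDeriv
    rw [fderiv_fun_add]
    · simp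
    · exact (d hη' x).mul (d hψ x)
    · exact (d hη x).mul (d hψ' x)
  rw [h1, h2, partialDeriv_mul i (d hη' x) (d hψ x), partialDeriv_mul i (d hη x) (d hψ' x)]
  ring

theorem helmholtz_cutoff_mul (z : ℂ) {η ψ : E3 → ℂ} (hη : ContDiff ℝ ∞ η)
    (hψ : ContDiff ℝ ∞ ψ) (t : ℝ) (x : E3) :
    helmholtz z (fun y => η (t • y) * ψ y) x = η (t • x) * helmholtz z ψ x -
      2 * t * ∑ i, partialDeriv i η (t • x) * partialDeriv i ψ x -
      t ^ 2 * (∑ i, partialDeriv i (partialDeriv i η) (t • x)) * ψ x := by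
  have hη' : ContDiff ℝ ∞ (fun y => η (t • y)) := hη.comp (contDiff_const_smul t)
  have h1 : ∀ i, partialDeriv i (partialDeriv i fun y => η (t • y) * ψ y) x =
      t ^ 2 * partialDeriv i (partialDeriv i η) (t • x) * ψ x +
      2 * (t * partialDeriv i η (t • x) * partialDeriv i ψ x) +
        η (t • x) * partialDeriv i (partialDeriv i ψ) x := fun i => by
    have hη'' : ContDiff ℝ ∞ (fun y => partialDeriv i η (t • y)) :=
      (contDiff_partialDeriv i hη).comp (contDiff_const_smul t)
    rw [partialDeriv_partialDeriv_mul i hη' hψ, partialDeriv_comp_smul,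
      partialDeriv_const_mul i _ hη'',
      partialDeriv_comp_smul]
    ring
  unfold helmholtz
  simp only [h1, Fin.sum_univ_three]
  ring

/-- A very weak solution, tested against the potential of a test function. -/
theorem IsVeryWeakSol.integral_mul_test {ζ : ℂ} (hζ : 0 < ζ.im) {u g : E3 → ℂ}
    (hu : ExpIntegrable u) (hg : ExpIntegrable g) (h : IsVeryWeakSol (ζ ^ 2) u g)
    {φ : E3 → ℂ} (hφ : ContDiff ℝ ∞ φ) (hc : HasCompactSupport φ) :
    ∫ x, u x * φ x = ∫ x, g x * greenConv ζ φ x := by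
  -- The potential `G ∗ φ` need not have compact support, so it is multiplied by `η(t x)` and `t →
  -- 0`.
  obtain ⟨b⟩ : Nonempty (ContDiffBump (0 : E3)) := ⟨⟨1, 2, one_pos, one_lt_two⟩⟩
  set η : E3 → ℂ := fun x => (b x : ℂ) with hηdef
  have hη : ContDiff ℝ ∞ η := Complex.ofRealCLM.contDiff.comp b.contDiff
  have hηc : HasCompactSupport η := b.hasCompactSupport.comp_left (g := fun t : ℝ => (t : ℂ)) rfl
  have hη0 : η 0 = 1 := by
    simp [hηdef, b.one_of_mem_closedBall (Metric.mem_closedBall_self b.rIn_pos.le)]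
  set ψ := greenConv ζ φ with hψdef
  have hψ : ContDiff ℝ ∞ ψ := contDiff_greenConv hζ hφ hc
  have hhψ : ∀ x, helmholtz (ζ ^ 2) ψ x = φ x := helmholtz_greenConv hζ hφ hc
  set c := ζ.im / 2 with hcdef
  have hc0 : 0 < c := half_pos hζ
  have hcζ : c < ζ.im := half_lt_self hζ
  -- exponential bounds
  have hb0 : ∃ C, ∀ x, ‖ψ x‖ ≤ C * Real.exp (-c * ‖x‖) := by
    obtain ⟨C, -, hC⟩ := exists_norm_le_exp hφ.continuous hc c
    exact ⟨_, norm_greenConv_le hc0.le hcζ hC⟩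
  have hb1 : ∀ i, ∃ C, ∀ x, ‖partialDeriv i ψ x‖ ≤ C * Real.exp (-c * ‖x‖) := fun i => by
    obtain ⟨C, -, hC⟩ := exists_norm_le_exp (partialDeriv_continuous i hφ)
      (partialDeriv_hasCompactSupport i hc) c
    rw [hψdef, partialDeriv_greenConv hζ i hφ hc]
    exact ⟨_, norm_greenConv_le hc0.le hcζ hC⟩
  have hb2 : ∃ C, ∀ x, ‖φ x‖ ≤ C * Real.exp (-c * ‖x‖) := by
    obtain ⟨C, -, hC⟩ := exists_norm_le_exp hφ.continuous hc c
    exact ⟨C, hC⟩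
  obtain ⟨Cψ, hCψ⟩ := hb0
  choose Cd hCd using hb1
  obtain ⟨Cφ, hCφ⟩ := hb2
  obtain ⟨Mη, hMη⟩ := hη.continuous.bounded_above_of_compact_support hηc
  have hMd : ∀ i, ∃ M, ∀ x, ‖partialDeriv i η x‖ ≤ M := fun i =>
    (partialDeriv_continuous i hη).bounded_above_of_compact_support
      (partialDeriv_hasCompactSupport i hηc)
  have hMdd : ∀ i, ∃ M, ∀ x, ‖partialDeriv i (partialDeriv i η) x‖ ≤ M := fun i =>
    (partialDeriv_continuous i (contDiff_partialDeriv i hη)).bounded_above_of_compact_support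
      (partialDeriv_hasCompactSupport i (partialDeriv_hasCompactSupport i hηc))
  choose Md hMd using hMd
  choose Mdd hMdd using hMdd
  have c0 := hη.continuous
  have c1 := fun i => partialDeriv_continuous i hη
  have c2 := fun i => partialDeriv_continuous i (contDiff_partialDeriv i hη)
  have c3 := hψ.continuous
  have c4 := fun i => partialDeriv_continuous i hψ
  have c5 := hφ.continuous
  -- the limit of the left-hand side
  let F : ℝ → E3 → ℂ := fun t x => η (t • x) * φ x -
      2 * t * ∑ i, partialDeriv i η (t • x) * partialDeriv i ψ x -
      t ^ 2 * (∑ i, partialDeriv i (partialDeriv i η) (t • x)) * ψ x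
  -- Each derivative of the cutoff carries a factor `t`, so only the term with `η 0 = 1` survives at
  -- `t = 0`.
  have hF0 : ∀ x, F 0 x = φ x := fun x => by simp [F, hη0]
  have hFt : ∀ t, Continuous (F t) := fun t => by
    fun_prop
  have hFx : ∀ x, Continuous fun t => F t x := fun x => by
    fun_prop
  set CF := Mη * Cφ + 2 * ∑ i, Md i * Cd i + (∑ i, Mdd i) * Cψ
  have hFb : ∀ t ∈ Set.Ioo (0 : ℝ) 1, ∀ x, ‖F t x‖ ≤ CF * Real.exp (-c * ‖x‖) := by
    intro t ht x
    have hM0 : 0 ≤ Mη := (norm_nonneg _).trans (hMη 0)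
    have hMd0 : ∀ i, 0 ≤ Md i := fun i => (norm_nonneg _).trans (hMd i 0)
    have hMdd0 : ∀ i, 0 ≤ Mdd i := fun i => (norm_nonneg _).trans (hMdd i 0)
    have e1 : ‖η (t • x) * φ x‖ ≤ Mη * (Cφ * Real.exp (-c * ‖x‖)) := by
      rw [norm_mul]
      exact mul_le_mul (hMη _) (hCφ x) (norm_nonneg _) hM0
    have e2 : ‖∑ i, partialDeriv i η (t • x) * partialDeriv i ψ x‖ ≤
        ∑ i, Md i * (Cd i * Real.exp (-c * ‖x‖)) := by
      refine norm_sum_le_of_le _ fun i _ => ?_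
      rw [norm_mul]
      exact mul_le_mul (hMd i _) (hCd i x) (norm_nonneg _) (hMd0 i)
    have e3 : ‖(∑ i, partialDeriv i (partialDeriv i η) (t • x)) * ψ x‖ ≤
        (∑ i, Mdd i) * (Cψ * Real.exp (-c * ‖x‖)) := by
      rw [norm_mul]
      exact mul_le_mul (norm_sum_le_of_le _ fun i _ => hMdd i _) (hCψ x) (norm_nonneg _)
        (Finset.sum_nonneg fun i _ => hMdd0 i)
    have ht1 : ‖(2 * t : ℂ)‖ ≤ 2 := by
      rw [norm_mul, Complex.norm_real, Real.norm_of_nonneg ht.1.le, Complex.norm_ofNat]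
      linarith [ht.2]
    have ht2 : ‖(t ^ 2 : ℂ)‖ ≤ 1 := by
      rw [norm_pow, Complex.norm_real, Real.norm_of_nonneg ht.1.le]
      nlinarith [ht.1, ht.2]
    calc ‖F t x‖ ≤ ‖η (t • x) * φ x‖ +
          ‖(2 * t : ℂ)‖ * ‖∑ i, partialDeriv i η (t • x) * partialDeriv i ψ x‖ +
          ‖(t ^ 2 : ℂ)‖ * ‖(∑ i, partialDeriv i (partialDeriv i η) (t • x)) * ψ x‖ := by
          rw [← norm_mul, ← norm_mul, ← mul_assoc]
          exact (norm_sub_le _ _).trans (add_le_add_left (norm_sub_le _ _) _)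
      _ ≤ Mη * (Cφ * Real.exp (-c * ‖x‖)) + 2 * ∑ i, Md i * (Cd i * Real.exp (-c * ‖x‖)) +
          1 * ((∑ i, Mdd i) * (Cψ * Real.exp (-c * ‖x‖))) := by
          gcongr
      _ = _ := by
          simp only [CF, Fin.sum_univ_three]
          ring
  have hlim1 : Tendsto (fun t => ∫ x, u x * F t x) (𝓝[>] 0) (𝓝 (∫ x, u x * φ x)) := by
    have hbi : Integrable (fun x => ‖u x * ((CF * Real.exp (-c * ‖x‖) : ℝ) : ℂ)‖) := by
      refine (hu.integrable_mul (by fun_prop : Continuous fun x : E3 =>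
        ((CF * Real.exp (-c * ‖x‖) : ℝ) : ℂ)).aestronglyMeasurable hc0 (C := |CF|) ?_).norm
      intro x
      rw [Complex.norm_real, norm_mul, Real.norm_of_nonneg (Real.exp_nonneg _), Real.norm_eq_abs]
    refine tendsto_integral_filter_of_dominated_convergence _ ?_ ?_ hbi ?_
    · exact Eventually.of_forall fun t =>
        hu.aestronglyMeasurable.mul (hFt t).aestronglyMeasurable
    · filter_upwards [Ioo_mem_nhdsGT one_pos] with t ht
      filter_upwards with x
      rw [norm_mul, norm_mul, Complex.norm_real]
      exact mul_le_mul_of_nonneg_left ((hFb t ht x).trans (le_abs_self _)) (norm_nonneg _)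
    · filter_upwards with x
      rw [← hF0 x]
      exact (((hFx x).tendsto 0).mono_left nhdsWithin_le_nhds).const_mul _
  have hlim2 : Tendsto (fun t : ℝ => ∫ x, g x * (η (t • x) * ψ x)) (𝓝[>] 0)
      (𝓝 (∫ x, g x * ψ x)) := by
    have hbi : Integrable (fun x => Mη * ‖g x * ψ x‖) :=
      ((hg.integrable_mul c3.aestronglyMeasurable hc0 hCψ).norm).const_mul _
    refine tendsto_integral_filter_of_dominated_convergence _ ?_ ?_ hbi ?_
    · exact Eventually.of_forall fun t => hg.aestronglyMeasurable.mul
        (by fun_prop : Continuous fun x => η (t • x) * ψ x).aestronglyMeasurable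
    · filter_upwards with t
      filter_upwards with x
      rw [mul_left_comm, norm_mul]
      exact mul_le_mul_of_nonneg_right (hMη _) (norm_nonneg _)
    · filter_upwards with x
      have : Continuous fun t : ℝ => g x * (η (t • x) * ψ x) := by fun_prop
      have h2 := (this.tendsto 0).mono_left (nhdsWithin_le_nhds (s := Set.Ioi 0))
      simpa [hη0] using h2
  refine tendsto_nhds_unique (hlim1.congr' ?_) hlim2
  filter_upwards [self_mem_nhdsWithin] with t ht
  have ht' : (0 : ℝ) < t := ht
  have hχc : HasCompactSupport (fun y => η (t • y) * ψ y) :=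
    HasCompactSupport.mul_right (hηc.comp_smul ht'.ne')
  have := h (fun y => η (t • y) * ψ y) ((hη.comp (contDiff_const_smul t)).mul hψ) hχc
  rw [← this]
  congr 1; ext x
  rw [helmholtz_cutoff_mul _ hη hψ, hhψ]

/-- A very weak solution of the Helmholtz equation is the Green potential of its right-hand side. -/
theorem IsVeryWeakSol.ae_eq_greenConv {ζ : ℂ} (hζ : 0 < ζ.im) {u g : E3 → ℂ}
    (hu : ExpIntegrable u) (hg : ExpIntegrable g) (h : IsVeryWeakSol (ζ ^ 2) u g) :
    u =ᵐ[volume] greenConv ζ g := by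
  refine ae_eq_of_integral_contDiff_smul_eq hu.locallyIntegrable
    (expIntegrable_greenConv hζ hg).locallyIntegrable fun φ hφ hc => ?_
  have hφ' : ContDiff ℝ ∞ (fun x => (φ x : ℂ)) := Complex.ofRealCLM.contDiff.comp hφ
  have hc' : HasCompactSupport (fun x => (φ x : ℂ)) :=
    hc.comp_left (g := fun t : ℝ => (t : ℂ)) (by simp)
  have h1 := h.integral_mul_test hζ hu hg hφ' hc'
  rw [integral_mul_greenConv hζ hg hφ'.continuous hc'] at h1
  simpa only [Complex.real_smul, mul_comm] using h1

/-! ### Stummel functions have exponentially weighted moments -/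

/-- Away from its centre the Stummel weight is bounded below, so the functional controls local `L_m`
norms uniformly. -/
theorem lintegral_ball_le_stummel (ν m : ℝ) (a : E3 → ℂ) (w : E3) :
    ∫⁻ y in Metric.ball w (1 / 4), ‖a y‖ₑ ^ m ≤
      (ENNReal.ofReal ((1 / 4) ^ |ν - 3|))⁻¹ * stummel ν m a := by
  -- Shifting the centre by `1/2` puts the ball of radius `1/4` where `1/4 ≤ |x - y| < 1`; the
  -- absolute value in `K` covers both signs of `ν - 3`.
  set x : E3 := w + EuclideanSpace.single 0 (1 / 2) with hx
  have hxw : ‖x - w‖ = 1 / 2 := by simp [hx]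
  set K : ℝ := (1 / 4) ^ |ν - 3| with hKdef
  have hK : 0 < K := by positivity
  have h1 : ∀ y ∈ Metric.ball w (1 / 4), 1 / 4 ≤ ‖x - y‖ ∧ ‖x - y‖ < 1 := by
    intro y hy
    rw [mem_ball_iff_norm] at hy
    have e1 := norm_sub_le (x - y) (w - y)
    have e2 := norm_add_le (x - w) (w - y)
    rw [sub_sub_sub_cancel_right] at e1
    rw [sub_add_sub_cancel] at e2
    rw [norm_sub_rev w y] at e1 e2
    constructor <;> linarith
  have h2 : ∀ y ∈ Metric.ball w (1 / 4), K ≤ ‖x - y‖ ^ (ν - 3) := by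
    intro y hy
    obtain ⟨e1, e2⟩ := h1 y hy
    rcases le_total 0 (ν - 3) with h | h
    · rw [hKdef, abs_of_nonneg h]
      exact Real.rpow_le_rpow (by norm_num) e1 h
    · refine le_trans ?_ (Real.one_le_rpow_of_pos_of_le_one_of_nonpos (by linarith) e2.le h)
      exact Real.rpow_le_one (by norm_num) (by norm_num) (abs_nonneg _)
  rw [mul_comm, ← div_eq_mul_inv, ENNReal.le_div_iff_mul_le (by simp [hK]) (by simp),
    ← lintegral_mul_const' _ _ ENNReal.ofReal_ne_top]
  calc ∫⁻ y in Metric.ball w (1 / 4), ‖a y‖ₑ ^ m * ENNReal.ofReal K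
      ≤ ∫⁻ y in Metric.ball w (1 / 4), ‖a y‖ₑ ^ m * ENNReal.ofReal (‖x - y‖ ^ (ν - 3)) := by
        refine setLIntegral_mono' Metric.isOpen_ball.measurableSet fun y hy => ?_
        gcongr
        exact h2 y hy
    _ ≤ ∫⁻ y in Metric.ball x 1, ‖a y‖ₑ ^ m * ENNReal.ofReal (‖x - y‖ ^ (ν - 3)) := by
        refine lintegral_mono_set fun y hy => ?_
        rw [mem_ball_iff_norm, norm_sub_rev]
        exact (h1 y hy).2
    _ ≤ stummel ν m a := le_iSup (fun x => ∫⁻ y in Metric.ball x 1,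
        ‖a y‖ₑ ^ m * ENNReal.ofReal (‖x - y‖ ^ (ν - 3))) x

/-- Integrate `exp (-c|w|) f(y)` over `|w - y| < r` in both orders. With `y` first it is at most `C
∫ exp (-c|w|)`; with `w` first it dominates a positive multiple of the desired integral. -/
theorem lintegral_exp_mul_lt_top {f : E3 → ℝ≥0∞} (hf : AEMeasurable f volume) {C : ℝ≥0∞}
    (hC : C < ⊤) {r : ℝ} (hr : 0 < r) (hfC : ∀ w, ∫⁻ y in Metric.ball w r, f y ≤ C) {c : ℝ}
    (hc : 0 < c) : ∫⁻ y, ENNReal.ofReal (Real.exp (-c * ‖y‖)) * f y < ⊤ := by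
  let S : Set (E3 × E3) := {q | dist q.2 q.1 < r}
  have hS : MeasurableSet S :=
    (isOpen_lt (by fun_prop : Continuous fun q : E3 × E3 => dist q.2 q.1)
      continuous_const).measurableSet
  let F : E3 → E3 → ℝ≥0∞ := fun w y =>
    S.indicator (fun q => ENNReal.ofReal (Real.exp (-c * ‖q.1‖)) * f q.2) (w, y)
  have hFm : AEMeasurable (Function.uncurry F) (volume.prod volume) := by
    refine AEMeasurable.indicator ?_ hS
    exact (by fun_prop : Measurable fun q : E3 × E3 =>
      ENNReal.ofReal (Real.exp (-c * ‖q.1‖))).aemeasurable.mul hf.comp_snd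
  have hF1 : ∀ w, ∫⁻ y, F w y ≤ ENNReal.ofReal (Real.exp (-c * ‖w‖)) * C := by
    intro w
    have : ∀ y, F w y = (Metric.ball w r).indicator
        (fun y => ENNReal.ofReal (Real.exp (-c * ‖w‖)) * f y) y := fun y => by
      simp only [F, S, Set.indicator, Set.mem_ofPred_eq, Metric.mem_ball]
    simp_rw [this]
    rw [lintegral_indicator Metric.isOpen_ball.measurableSet,
      lintegral_const_mul' _ _ ENNReal.ofReal_ne_top]
    gcongr
    exact hfC w
  set V := volume (Metric.ball (0 : E3) r) with hV
  have hV0 : V ≠ 0 := (Metric.measure_ball_pos volume _ hr).ne'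
  have hVt : V ≠ ⊤ := measure_ball_lt_top.ne
  have hF2 : ∀ y, ENNReal.ofReal (Real.exp (-c * r)) * V *
      (ENNReal.ofReal (Real.exp (-c * ‖y‖)) * f y) ≤ ∫⁻ w, F w y := by
    intro y
    have : ∀ w, F w y = (Metric.ball y r).indicator
        (fun w => ENNReal.ofReal (Real.exp (-c * ‖w‖)) * f y) w := fun w => by
      simp only [F, S, Set.indicator, Set.mem_ofPred_eq, Metric.mem_ball, dist_comm w y]
    simp_rw [this]
    rw [lintegral_indicator Metric.isOpen_ball.measurableSet]
    calc _ = ∫⁻ w in Metric.ball y r, ENNReal.ofReal (Real.exp (-c * r)) *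
          (ENNReal.ofReal (Real.exp (-c * ‖y‖)) * f y) := by
          rw [setLIntegral_const, Measure.addHaar_ball_center volume y r, ← hV]
          ring
      _ ≤ _ := by
          refine setLIntegral_mono' Metric.isOpen_ball.measurableSet fun w hw => ?_
          rw [← mul_assoc, ← ENNReal.ofReal_mul (Real.exp_nonneg _), ← Real.exp_add]
          gcongr
          rw [mem_ball_iff_norm] at hw
          have := norm_le_norm_add_norm_sub y w
          rw [norm_sub_rev] at hw
          have := norm_le_norm_add_norm_sub' w y
          rw [norm_sub_rev] at this
          nlinarith
  have hEt : ∫⁻ w : E3, ENNReal.ofReal (Real.exp (-c * ‖w‖)) < ⊤ :=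
    (integrable_exp_neg_norm hc).lintegral_lt_top
  have hprod : ENNReal.ofReal (Real.exp (-c * r)) * V *
      ∫⁻ y, ENNReal.ofReal (Real.exp (-c * ‖y‖)) * f y < ⊤ := by
    calc _ ≤ ∫⁻ y, ∫⁻ w, F w y := by
          rw [← lintegral_const_mul' _ _ (ENNReal.mul_ne_top ENNReal.ofReal_ne_top hVt)]
          exact lintegral_mono hF2
      _ = ∫⁻ w, ∫⁻ y, F w y := (lintegral_lintegral_swap hFm).symm
      _ ≤ ∫⁻ w : E3, ENNReal.ofReal (Real.exp (-c * ‖w‖)) * C := lintegral_mono hF1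
      _ = (∫⁻ w : E3, ENNReal.ofReal (Real.exp (-c * ‖w‖))) * C :=
          lintegral_mul_const' _ _ hC.ne
      _ < ⊤ := ENNReal.mul_lt_top hEt hC
  refine lt_top_iff_ne_top.2 fun htop => hprod.ne ?_
  rw [htop]
  exact ENNReal.mul_top (mul_ne_zero (by simp [Real.exp_pos]) hV0)

theorem memLp_exp_smul_of_stummel {ν m : ℝ} (hm : 0 < m) {a : E3 → ℂ}
    (ha : AEStronglyMeasurable a volume) (hs : stummel ν m a < ⊤) {c : ℝ} (hc : 0 < c) :
    MemLp (fun x => Real.exp (-c * ‖x‖) • a x) (ENNReal.ofReal m) volume := by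
  refine ⟨(by fun_prop : Continuous fun x : E3 =>
    Real.exp (-c * ‖x‖)).aestronglyMeasurable.smul ha, ?_⟩
  rw [eLpNorm_lt_top_iff_lintegral_rpow_enorm_lt_top (by simpa using hm) ENNReal.ofReal_ne_top,
    ENNReal.toReal_ofReal hm.le]
  have hK : (0 : ℝ) < (1 / 4) ^ |ν - 3| := by positivity
  have h := lintegral_exp_mul_lt_top (f := fun y => ‖a y‖ₑ ^ m) (ha.enorm.pow_const m)
    (C := (ENNReal.ofReal ((1 / 4) ^ |ν - 3|))⁻¹ * stummel ν m a)
    (ENNReal.mul_lt_top (ENNReal.inv_lt_top.2 (ENNReal.ofReal_pos.2 hK)) hs) (r := 1 / 4) (by norm_num)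
    (lintegral_ball_le_stummel ν m a) (mul_pos hc hm)
  refine (lintegral_congr fun x => ?_).trans_lt h
  rw [enorm_exp_smul, ENNReal.mul_rpow_of_nonneg _ _ hm.le,
    ENNReal.ofReal_rpow_of_nonneg (Real.exp_nonneg _) hm.le, ← Real.exp_mul]
  ring_nf

theorem memLp_exp_smul_one {m : ℝ} (hm : 0 < m) {c : ℝ} (hc : 0 < c) :
    MemLp (fun x : E3 => Real.exp (-c * ‖x‖) • (1 : ℂ)) (ENNReal.ofReal m) volume := by
  have hcont : Continuous fun x : E3 => Real.exp (-c * ‖x‖) • (1 : ℂ) := by fun_prop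
  rw [← integrable_norm_rpow_iff hcont.aestronglyMeasurable (by simpa using hm)
    ENNReal.ofReal_ne_top, ENNReal.toReal_ofReal hm.le]
  refine (integrable_exp_neg_norm (mul_pos hc hm)).congr (Eventually.of_forall fun x => ?_)
  simp only
  rw [norm_smul, norm_one, mul_one, Real.norm_of_nonneg (Real.exp_nonneg _), ← Real.exp_mul]
  ring_nf

/-! ### Products of weighted `L_q` functions with `L_p` functions -/

/-- `a` belongs to `L_q` with every exponentially decaying weight. -/
def ExpMemLp (q : ℝ≥0∞) (a : E3 → ℂ) : Prop :=
  ∀ c : ℝ, 0 < c → MemLp (fun x => Real.exp (-c * ‖x‖) • a x) q volume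

section Holder

variable {p q : ℝ≥0∞} {a : E3 → ℂ}

theorem ExpMemLp.expIntegrable_mul [q.HolderConjugate p] (ha : ExpMemLp q a) (w : LpC p) :
    ExpIntegrable (fun x => a x * w x) := by
  intro c hc
  refine ((ha c hc).integrable_mul (Lp.memLp w)).congr (Eventually.of_forall fun x => ?_)
  simp [mul_assoc]

theorem ExpMemLp.expIntegrable_coe [q.HolderConjugate p] (h1 : ExpMemLp q (fun _ => 1))
    (w : LpC p) : ExpIntegrable w := by
  simpa using h1.expIntegrable_mul w

/-- By Hölder, multiplication by `a` is continuous from `L_p` to weighted `L_1`. -/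
theorem ExpMemLp.tendsto_lintegral [Fact (1 ≤ p)] [q.HolderConjugate p] (ha : ExpMemLp q a)
    {w : ℕ → LpC p} {w₀ : LpC p} (hw : Tendsto w atTop (𝓝 w₀)) {c : ℝ} (hc : 0 < c) :
    Tendsto (fun n => ∫⁻ x, ‖Real.exp (-c * ‖x‖) • (a x * w n x - a x * w₀ x)‖ₑ) atTop
      (𝓝 0) := by
  have h1 : Tendsto (fun n => eLpNorm (fun x => Real.exp (-c * ‖x‖) • a x) q volume *
      eLpNorm (⇑(w n) - ⇑w₀) p volume) atTop (𝓝 0) := by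
    have := ENNReal.Tendsto.const_mul (Lp.tendsto_Lp_iff_tendsto_eLpNorm' w w₀ |>.1 hw)
      (Or.inr (ha c hc).2.ne)
    simpa using this
  refine tendsto_of_tendsto_of_tendsto_of_le_of_le tendsto_const_nhds h1 (fun _ => zero_le)
    fun n => ?_
  have h2 := eLpNorm_smul_le_mul_eLpNorm (p := q) (q := p) (r := 1)
    ((Lp.aestronglyMeasurable (w n)).sub (Lp.aestronglyMeasurable w₀)) (ha c hc).1
  refine le_trans ?_ h2
  rw [eLpNorm_one_eq_lintegral_enorm]
  refine lintegral_mono fun x => le_of_eq ?_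
  congr 1
  simp only [Pi.smul_apply', Pi.sub_apply, smul_eq_mul, Complex.real_smul]
  ring

theorem ExpMemLp.tendsto_ae_greenConv [Fact (1 ≤ p)] [q.HolderConjugate p] {ζ : ℂ}
    (hζ : 0 < ζ.im) (ha : ExpMemLp q a) {w : ℕ → LpC p} {w₀ : LpC p}
    (hw : Tendsto w atTop (𝓝 w₀)) :
    ∃ ns : ℕ → ℕ, StrictMono ns ∧ ∀ᵐ x, Tendsto
      (fun n => greenConv ζ (fun y => a y * w (ns n) y) x) atTop
        (𝓝 (greenConv ζ (fun y => a y * w₀ y) x)) := by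
  set c := ζ.im / 2
  have hc : 0 < c := half_pos hζ
  have hcζ : c < ζ.im := half_lt_self hζ
  have hE : ∀ w : LpC p, ExpIntegrable (greenConv ζ (fun y => a y * w y)) := fun w =>
    expIntegrable_greenConv hζ (ha.expIntegrable_mul w)
  have hlim : Tendsto (fun n => eLpNorm
      ((fun x : E3 => Real.exp (-c * ‖x‖) • greenConv ζ (fun y => a y * w n y) x) -
        fun x : E3 => Real.exp (-c * ‖x‖) • greenConv ζ (fun y => a y * w₀ y) x) 1 volume)
      atTop (𝓝 0) := by
    have h1 := ENNReal.Tendsto.const_mul (ha.tendsto_lintegral hw hc)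
      (Or.inr (lintegral_yukawa_lt_top (sub_pos.2 hcζ)).ne)
    rw [mul_zero] at h1
    refine tendsto_of_tendsto_of_tendsto_of_le_of_le tendsto_const_nhds h1 (fun _ => zero_le)
      fun n => ?_
    have h2 := lintegral_exp_smul_greenConv_le (ζ := ζ) hc
      ((ha.expIntegrable_mul (w n)).sub (ha.expIntegrable_mul w₀)).aestronglyMeasurable
    refine le_trans (le_of_eq ?_) h2
    rw [eLpNorm_one_eq_lintegral_enorm]
    refine lintegral_congr_ae ?_
    filter_upwards [greenConv_sub_ae hζ (ha.expIntegrable_mul (w n)) (ha.expIntegrable_mul w₀)]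
      with x hx
    rw [Pi.sub_apply, ← smul_sub, hx]
  obtain ⟨ns, hns, hae⟩ := (tendstoInMeasure_of_tendsto_eLpNorm one_ne_zero
    (fun n => (hE (w n) c hc).aestronglyMeasurable) (hE w₀ c hc).aestronglyMeasurable
    hlim).exists_seq_tendsto_ae
  refine ⟨ns, hns, ?_⟩
  filter_upwards [hae] with x hx
  have := hx.const_smul (Real.exp (c * ‖x‖))
  have he : ∀ v : ℂ, Real.exp (c * ‖x‖) • Real.exp (-c * ‖x‖) • v = v := fun v => by
    rw [smul_smul, ← Real.exp_add]
    simp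
  simpa only [he] using this

/-- The operator `w ↦ β · (G ∗ (a w))` has a closed graph in `L_p`. -/
theorem ExpMemLp.ae_eq_of_tendsto [Fact (1 ≤ p)] [q.HolderConjugate p] {ζ : ℂ}
    (hζ : 0 < ζ.im) (ha : ExpMemLp q a) (β : E3 → ℂ) {w v : ℕ → LpC p} {w₀ v₀ : LpC p}
    (hw : Tendsto w atTop (𝓝 w₀)) (hv : Tendsto v atTop (𝓝 v₀))
    (h : ∀ n, v n =ᵐ[volume] fun x => β x * greenConv ζ (fun y => a y * w n y) x) :
    v₀ =ᵐ[volume] fun x => β x * greenConv ζ (fun y => a y * w₀ y) x := by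
  obtain ⟨ns, hns, h1⟩ := ha.tendsto_ae_greenConv hζ hw
  -- A further subsequence, along which both sides converge almost everywhere.
  obtain ⟨ms, hms, h2⟩ := (tendstoInMeasure_of_tendsto_Lp
    (hv.comp hns.tendsto_atTop)).exists_seq_tendsto_ae
  have h3 : ∀ᵐ x, ∀ n, v n x = β x * greenConv ζ (fun y => a y * w n y) x := ae_all_iff.2 h
  filter_upwards [h1, h2, h3] with x h1 h2 h3
  refine tendsto_nhds_unique h2 ?_
  have := (h1.comp hms.tendsto_atTop).const_mul (β x)
  refine this.congr fun n => ?_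
  simp only [Function.comp_apply]
  exact (h3 _).symm

end Holder

/-! ### Graphs of partially defined operators -/

section Graphs

variable {E : Type*} [NormedAddCommGroup E] [NormedSpace ℂ E]

theorem mem_graph_shiftOp {T : E →ₗ.[ℂ] E} {z : ℂ} {x y : E} :
    (x, y) ∈ (shiftOp T z).graph ↔ (x, y + z • x) ∈ T.graph := by
  rw [LinearPMap.mem_graph_iff, LinearPMap.mem_graph_iff]
  constructor
  · rintro ⟨⟨x', hx'⟩, h1, h2⟩
    refine ⟨⟨x', hx'⟩, h1, ?_⟩
    simp only at h1 h2 ⊢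
    rw [← h2, ← h1]
    exact (sub_add_cancel (T ⟨x', hx'⟩) (z • x')).symm
  · rintro ⟨⟨x', hx'⟩, h1, h2⟩
    refine ⟨⟨x', hx'⟩, h1, ?_⟩
    simp only at h1 h2 ⊢
    refine (?_ : T ⟨x', hx'⟩ - z • x' = y)
    rw [h2, h1, add_sub_cancel_right]

theorem mem_graph_compOp {S T : E →ₗ.[ℂ] E} {x y : E} :
    (x, y) ∈ (compOp S T).graph ↔ ∃ t, (x, t) ∈ T.graph ∧ (t, y) ∈ S.graph := by
  constructor
  · intro h
    obtain ⟨⟨x', hx'⟩, h1, h2⟩ := LinearPMap.mem_graph_iff _ |>.1 h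
    simp only at h1 h2
    subst h1
    obtain ⟨hT, hS⟩ := (mem_compOp_domain_iff S T x').1 hx'
    refine ⟨T ⟨x', hT⟩, LinearPMap.mem_graph T ⟨x', hT⟩, ?_⟩
    rw [← h2, compOp_apply S T x' hx' hT hS]
    exact LinearPMap.mem_graph S ⟨_, hS⟩
  · rintro ⟨t, h1, h2⟩
    obtain ⟨⟨x', hx'⟩, e1, e2⟩ := LinearPMap.mem_graph_iff _ |>.1 h1
    obtain ⟨⟨t', ht'⟩, e3, e4⟩ := LinearPMap.mem_graph_iff _ |>.1 h2
    simp only at e1 e2 e3 e4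
    subst e1 e2 e3
    have hc : x' ∈ (compOp S T).domain := (mem_compOp_domain_iff S T x').2 ⟨hx', ht'⟩
    rw [← e4, ← compOp_apply S T x' hc hx' ht']
    exact LinearPMap.mem_graph _ ⟨x', hc⟩

/-- Injectivity ensures that the reversed graph is the graph of an operator, so it must be supplied
for every inverse in the definition of `H`. -/
theorem mem_graph_inverse {T : E →ₗ.[ℂ] E} (hT : ∀ x, (x, 0) ∈ T.graph → x = 0) {x y : E} :
    (y, x) ∈ T.inverse.graph ↔ (x, y) ∈ T.graph := by
  have hker : T.toFun.ker = ⊥ := by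
    rw [LinearMap.ker_eq_bot']
    intro x hx
    refine Subtype.ext (hT x ?_)
    have := LinearPMap.mem_graph T x
    rwa [show T x = 0 from hx] at this
  rw [LinearPMap.inverse_graph hker, Submodule.mem_map]
  constructor
  · rintro ⟨⟨x', y'⟩, h, e⟩
    obtain ⟨rfl, rfl⟩ := Prod.ext_iff.1 e
    exact h
  · exact fun h => ⟨(x, y), h, rfl⟩

theorem mem_graph_resolventOp {T : E →ₗ.[ℂ] E} {z : ℂ}
    (hT : ∀ x, (x, z • x) ∈ T.graph → x = 0) {x y : E} :
    (y, x) ∈ (resolventOp T z).graph ↔ (x, y + z • x) ∈ T.graph := by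
  unfold resolventOp
  rw [mem_graph_inverse, mem_graph_shiftOp]
  intro x hx
  rw [mem_graph_shiftOp, zero_add] at hx
  exact hT x hx

theorem IsRegularPoint.eq_zero {T : E →ₗ.[ℂ] E} {z : ℂ} (h : IsRegularPoint T z) (x : E)
    (hx : (x, z • x) ∈ T.graph) : x = 0 := by
  obtain ⟨S, hS, -⟩ := h
  rw [← zero_add (z • x), ← mem_graph_shiftOp] at hx
  obtain ⟨x', h1, h2⟩ := LinearPMap.mem_graph_iff _ |>.1 hx
  have := hS x'
  rw [h2, map_zero] at this
  exact (this.trans h1).symm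

theorem exists_seq_of_mem_graph_closure {T : E →ₗ.[ℂ] E} {x y : E}
    (h : (x, y) ∈ T.closure.graph) :
    ∃ (u v : ℕ → E), (∀ n, (u n, v n) ∈ T.graph) ∧ Tendsto u atTop (𝓝 x) ∧
      Tendsto v atTop (𝓝 y) := by
  have h1 : (x, y) ∈ T.graph.topologicalClosure := by
    by_cases hT : T.IsClosable
    · rwa [hT.graph_closure_eq_closure_graph]
    -- For a non-closable operator `closure` is by convention the operator itself, so closability
    -- need not be proved.
    · rw [LinearPMap.closure_def' hT] at h
      exact T.graph.le_topologicalClosure h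
  obtain ⟨s, hs, hlim⟩ := mem_closure_iff_seq_limit.1 h1
  exact ⟨fun n => (s n).1, fun n => (s n).2, hs, (continuous_fst.tendsto _).comp hlim,
    (continuous_snd.tendsto _).comp hlim⟩

theorem exists_of_mem_graph_sub {S T : E →ₗ.[ℂ] E} {x y : E} (h : (x, y) ∈ (S - T).graph) :
    ∃ s t, (x, s) ∈ S.graph ∧ (x, t) ∈ T.graph ∧ y = s - t := by
  obtain ⟨⟨x', hx'⟩, h1, h2⟩ := LinearPMap.mem_graph_iff _ |>.1 h
  simp only at h1 h2
  subst h1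
  exact ⟨S ⟨x', hx'.1⟩, T ⟨x', hx'.2⟩, LinearPMap.mem_graph S ⟨x', hx'.1⟩,
    LinearPMap.mem_graph T ⟨x', hx'.2⟩, h2.symm⟩

end Graphs

/-! ### Very weak solutions: algebra -/

theorem ExpIntegrable.integrable_mul_test {g : E3 → ℂ} (hg : ExpIntegrable g) {χ : E3 → ℂ}
    (hχ : Continuous χ) (hc : HasCompactSupport χ) : Integrable (fun x => g x * χ x) := by
  obtain ⟨C, -, hC⟩ := exists_norm_le_exp hχ hc 1
  exact hg.integrable_mul hχ.aestronglyMeasurable one_pos hC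

theorem IsVeryWeakSol.congr {z : ℂ} {u g u' g' : E3 → ℂ} (h : IsVeryWeakSol z u g)
    (hu : u =ᵐ[volume] u') (hg : g =ᵐ[volume] g') : IsVeryWeakSol z u' g' := by
  intro χ hχ hc
  have e1 : ∫ x, u' x * helmholtz z χ x = ∫ x, u x * helmholtz z χ x := by
    refine integral_congr_ae ?_
    filter_upwards [hu] with x hx
    rw [hx]
  have e2 : ∫ x, g' x * χ x = ∫ x, g x * χ x := by
    refine integral_congr_ae ?_
    filter_upwards [hg] with x hx
    rw [hx]
  rw [e1, e2, h χ hχ hc]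

theorem IsVeryWeakSol.sub {z : ℂ} {u g v h : E3 → ℂ} (hu : IsVeryWeakSol z u g)
    (hv : IsVeryWeakSol z v h) (iu : ExpIntegrable u) (ig : ExpIntegrable g)
    (iv : ExpIntegrable v) (ih : ExpIntegrable h) :
    IsVeryWeakSol z (fun x => u x - v x) (fun x => g x - h x) := by
  intro χ hχ hc
  have hH := continuous_helmholtz z hχ
  have hHc := hasCompactSupport_helmholtz z hc
  simp only [sub_mul]
  rw [integral_sub (iu.integrable_mul_test hH hHc) (iv.integrable_mul_test hH hHc),
    integral_sub (ig.integrable_mul_test hχ.continuous hc)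
      (ih.integrable_mul_test hχ.continuous hc), hu χ hχ hc, hv χ hχ hc]

/-- Used to pass from `-Δ` to `-Δ - z`, and from the reference point `z` to the eigenvalue. -/
theorem IsVeryWeakSol.shift {z : ℂ} {u g : E3 → ℂ} (h : IsVeryWeakSol z u g)
    (iu : ExpIntegrable u) (ig : ExpIntegrable g) (l : ℂ) :
    IsVeryWeakSol l u (fun x => g x - (l - z) * u x) := by
  intro χ hχ hc
  have j1 := iu.integrable_mul_test (continuous_helmholtz z hχ) (hasCompactSupport_helmholtz z hc)
  have j2 := (iu.integrable_mul_test hχ.continuous hc).const_mul (l - z)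
  have j3 := ig.integrable_mul_test hχ.continuous hc
  calc ∫ x, u x * helmholtz l χ x
      = ∫ x, (u x * helmholtz z χ x - (l - z) * (u x * χ x)) := by
        congr 1; ext x; simp only [helmholtz]; ring
    _ = ∫ x, (g x * χ x - (l - z) * (u x * χ x)) := by
        rw [integral_sub j1 j2, integral_sub j3 j2, h χ hχ hc]
    _ = _ := by congr 1; ext x; ring

/-- A Green potential is a very weak solution. -/
theorem isVeryWeakSol_greenConv {ζ : ℂ} (hζ : 0 < ζ.im) {g : E3 → ℂ} (hg : ExpIntegrable g) :
    IsVeryWeakSol (ζ ^ 2) (greenConv ζ g) g := by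
  intro χ hχ hc
  have hH := continuous_helmholtz (ζ ^ 2) hχ
  have hHc := hasCompactSupport_helmholtz (ζ ^ 2) hc
  have hE : ∀ {φ : E3 → ℂ}, Continuous φ → HasCompactSupport φ → ExpIntegrable φ :=
    fun {φ} h1 h2 c _ => (by fun_prop : Continuous fun x : E3 =>
      Real.exp (-c * ‖x‖) • φ x).integrable_of_hasCompactSupport
        (h2.smul_left (f := fun x : E3 => Real.exp (-c * ‖x‖)))
  have hw : IsVeryWeakSol (ζ ^ 2) χ (helmholtz (ζ ^ 2) χ) := fun φ hφ hcφ =>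
    integral_mul_helmholtz _ hχ hφ hcφ
  -- Uniqueness applied to `χ` itself gives `χ = G ∗ (-Δχ - ζ²χ)`.
  have hae := hw.ae_eq_greenConv hζ (hE hχ.continuous hc) (hE hH hHc)
  rw [← integral_mul_greenConv hζ hg hH hHc]
  refine integral_congr_ae ?_
  filter_upwards [hae] with x hx
  rw [← hx]

/-! ### The free resolvent -/

theorem exists_sqrt_im_pos {z : ℂ} (hz : z ∉ ((↑) : ℝ → ℂ) '' Set.Ici 0) :
    ∃ ζ : ℂ, ζ ^ 2 = z ∧ 0 < ζ.im := by
  obtain ⟨ζ, hζ⟩ := IsAlgClosed.exists_pow_nat_eq z two_pos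
  rcases lt_trichotomy ζ.im 0 with h | h | h
  · exact ⟨-ζ, by rw [neg_sq, hζ], by simpa using h⟩
  · refine absurd ⟨ζ.re ^ 2, Set.mem_Ici.2 (sq_nonneg _), ?_⟩ hz
    rw [← hζ]
    have : ζ = (ζ.re : ℂ) := Complex.ext rfl (by simpa using h)
    rw [this]
    simp
  · exact ⟨ζ, hζ, h⟩

section Resolvent

variable {p q : ℝ≥0∞} [Fact (1 ≤ p)] {a b : E3 → ℂ} {ζ : ℂ}

theorem isVeryWeakSol_of_mem_freeGraph {y f : LpC p} (h : (y, f) ∈ (freeOp p).graph) :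
    IsVeryWeakSol 0 y f := by
  rw [freeOp_graph] at h
  obtain ⟨d, dd, h1, h2, h3⟩ := h
  simp only at h1 h3
  intro χ hχ hc
  have hcont := fun i => partialDeriv_continuous i (contDiff_partialDeriv i hχ)
  have hsupp := fun i => partialDeriv_hasCompactSupport i (partialDeriv_hasCompactSupport i hc)
  have e1 : ∀ i, ∫ x, y x * partialDeriv i (partialDeriv i χ) x = ∫ x, dd i i x * χ x := fun i => by
    rw [h1 i _ (contDiff_partialDeriv i hχ) (partialDeriv_hasCompactSupport i hc),
      h2 i i χ hχ hc, neg_neg]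
  have i1 := fun i => integrable_Lp_mul_test y (hcont i) (hsupp i)
  have i2 := fun i => integrable_Lp_mul_test (dd i i) hχ.continuous hc
  have e2 : f =ᵐ[volume] fun x => -∑ i, dd i i x := by
    rw [h3, Fin.sum_univ_three]
    filter_upwards [Lp.coeFn_neg (dd 0 0 + dd 1 1 + dd 2 2), Lp.coeFn_add (dd 0 0 + dd 1 1)
      (dd 2 2), Lp.coeFn_add (dd 0 0) (dd 1 1)] with x x1 x2 x3
    rw [x1, Pi.neg_apply, x2, Pi.add_apply, x3, Pi.add_apply, Fin.sum_univ_three]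
  calc ∫ x, y x * helmholtz 0 χ x
      = ∫ x, -∑ i, y x * partialDeriv i (partialDeriv i χ) x := by
        congr 1; ext x; simp only [helmholtz, zero_mul, sub_zero, mul_neg, Finset.mul_sum]
    _ = ∫ x, -∑ i, dd i i x * χ x := by
        rw [integral_neg, integral_neg, integral_finsetSum _ fun i _ => i1 i,
          integral_finsetSum _ fun i _ => i2 i]
        simp only [e1]
    _ = ∫ x, f x * χ x := by
        refine integral_congr_ae ?_
        filter_upwards [e2] with x hx
        rw [hx, neg_mul, Finset.sum_mul]

theorem isVeryWeakSol_of_mem_graph_freeOp [q.HolderConjugate p] (h1 : ExpMemLp q (fun _ => 1))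
    (z : ℂ) {y f : LpC p} (h : (y, f + z • y) ∈ (freeOp p).graph) : IsVeryWeakSol z y f := by
  have := (isVeryWeakSol_of_mem_freeGraph h).shift (h1.expIntegrable_coe y)
    (h1.expIntegrable_coe _) z
  refine this.congr EventuallyEq.rfl ?_
  filter_upwards [Lp.coeFn_add f (z • y), Lp.coeFn_smul z y] with x e1 e2
  rw [e1, Pi.add_apply, e2, Pi.smul_apply, smul_eq_mul]
  ring

/-- The potential of zero is zero; this makes `resolventOp (freeOp p) (ζ ^ 2)` the genuine inverse.
-/
theorem eq_zero_of_mem_graph_freeOp [q.HolderConjugate p] (h1 : ExpMemLp q (fun _ => 1))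
    (hζ : 0 < ζ.im) {y : LpC p} (h : (y, ζ ^ 2 • y) ∈ (freeOp p).graph) : y = 0 := by
  have hw : IsVeryWeakSol (ζ ^ 2) y (0 : LpC p) :=
    isVeryWeakSol_of_mem_graph_freeOp h1 _ (by rwa [zero_add])
  have h2 := hw.ae_eq_greenConv hζ (h1.expIntegrable_coe y) (h1.expIntegrable_coe _)
  rw [greenConv_congr (Lp.coeFn_zero ℂ p volume)] at h2
  rw [Lp.eq_zero_iff_ae_eq_zero]
  filter_upwards [h2] with x hx
  simp [hx, greenConv]

theorem isVeryWeakSol_of_mem_graph_resolventOp [q.HolderConjugate p]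
    (h1 : ExpMemLp q (fun _ => 1)) (hζ : 0 < ζ.im) {y f : LpC p}
    (h : (f, y) ∈ (resolventOp (freeOp p) (ζ ^ 2)).graph) : IsVeryWeakSol (ζ ^ 2) y f := by
  have hinj : ∀ x : LpC p, (x, ζ ^ 2 • x) ∈ (freeOp p).graph → x = 0 := fun x hx =>
    eq_zero_of_mem_graph_freeOp h1 hζ hx
  rw [mem_graph_resolventOp hinj] at h
  exact isVeryWeakSol_of_mem_graph_freeOp h1 _ h

theorem ae_eq_of_mem_graph_mulOp {w f : LpC p} (h : (w, f) ∈ (mulOp p a).graph) :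
    f =ᵐ[volume] fun x => a x * w x := by
  rw [mulOp_graph] at h
  exact h

theorem ae_eq_greenConv_of_mem_graph_comp [q.HolderConjugate p] (h1 : ExpMemLp q (fun _ => 1))
    (hζ : 0 < ζ.im) {w y : LpC p}
    (h : (w, y) ∈ (compOp (resolventOp (freeOp p) (ζ ^ 2)) (mulOp p a)).graph) :
    y =ᵐ[volume] greenConv ζ (fun x => a x * w x) := by
  obtain ⟨f, hf, hy⟩ := mem_graph_compOp.1 h
  have h2 := (isVeryWeakSol_of_mem_graph_resolventOp h1 hζ hy).ae_eq_greenConv hζ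
    (h1.expIntegrable_coe y) (h1.expIntegrable_coe f)
  rwa [greenConv_congr (ae_eq_of_mem_graph_mulOp hf)] at h2

theorem ae_eq_of_mem_graph_halfBorderedResolvent [q.HolderConjugate p]
    (h1 : ExpMemLp q (fun _ => 1)) (ha : ExpMemLp q a) (hζ : 0 < ζ.im) {w h : LpC p}
    (hw : (w, h) ∈ (halfBorderedResolvent p a (ζ ^ 2)).graph) :
    h =ᵐ[volume] greenConv ζ (fun x => a x * w x) := by
  obtain ⟨u, v, huv, hu, hv⟩ := exists_seq_of_mem_graph_closure hw
  have := ha.ae_eq_of_tendsto hζ (fun _ => 1) hu hv fun n => by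
    simpa only [one_mul] using ae_eq_greenConv_of_mem_graph_comp h1 hζ (huv n)
  simpa only [one_mul] using this

theorem ae_eq_of_mem_graph_borderedResolvent [q.HolderConjugate p]
    (h1 : ExpMemLp q (fun _ => 1)) (ha : ExpMemLp q a) (hζ : 0 < ζ.im) {w v : LpC p}
    (hw : (w, v) ∈ (borderedResolvent p a b (ζ ^ 2)).graph) :
    v =ᵐ[volume] fun x => b x * greenConv ζ (fun x => a x * w x) x := by
  obtain ⟨u, v, huv, hu, hv⟩ := exists_seq_of_mem_graph_closure hw
  refine ha.ae_eq_of_tendsto hζ b hu hv fun n => ?_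
  obtain ⟨y, hy, hvy⟩ := mem_graph_compOp.1 (huv n)
  filter_upwards [ae_eq_greenConv_of_mem_graph_comp h1 hζ hy, ae_eq_of_mem_graph_mulOp hvy]
    with x e1 e2
  rw [e2, e1]

/-! ### The perturbed resolvent -/

/-- If `u` is the image of `g` under the perturbed resolvent, then `b u ∈ L_p` and
`-Δu - zu = g - a (b u)`. -/
theorem exists_of_mem_graph_perturbedResolvent [q.HolderConjugate p]
    (h1 : ExpMemLp q (fun _ => 1)) (ha : ExpMemLp q a) (hζ : 0 < ζ.im)
    (hreg : IsRegularPoint (borderedResolvent p a b (ζ ^ 2)) (-1)) {g u : LpC p}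
    (h : (g, u) ∈ (perturbedResolvent p a b (ζ ^ 2)).graph) :
    ∃ w : LpC p, w =ᵐ[volume] (fun x => b x * u x) ∧
      IsVeryWeakSol (ζ ^ 2) u (fun x => g x - a x * w x) := by
  obtain ⟨y, v, hy, hv, huv⟩ := exists_of_mem_graph_sub h
  obtain ⟨w, hw, hwv⟩ := mem_graph_compOp.1 hv
  obtain ⟨β, hβ, hβw⟩ := mem_graph_compOp.1 hw
  obtain ⟨y', hy', hyβ⟩ := mem_graph_compOp.1 hβ
  have hyy : y = y' := LinearPMap.mem_graph_snd_inj _ hy hy' rfl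
  subst hyy
  -- Now `Q w = β - w` with `β = b y`, hence `w = b (y - v) = b u`.
  rw [mem_graph_resolventOp hreg.eq_zero] at hβw
  have eu : u =ᵐ[volume] fun x => y x - v x := by
    rw [huv]
    exact Lp.coeFn_sub y v
  have ev := ae_eq_of_mem_graph_halfBorderedResolvent h1 ha hζ hwv
  have eQ := ae_eq_of_mem_graph_borderedResolvent h1 ha hζ hβw
  refine ⟨w, ?_, ?_⟩
  · filter_upwards [eu, ev, eQ, ae_eq_of_mem_graph_mulOp hyβ, Lp.coeFn_add β ((-1 : ℂ) • w),
      Lp.coeFn_smul (-1 : ℂ) w] with x e1 e2 e3 e4 e5 e6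
    rw [e5, Pi.add_apply, e6, Pi.smul_apply, smul_eq_mul, e4, ← e2] at e3
    rw [e1]
    linear_combination -e3
  · have iw := ha.expIntegrable_mul w
    have wv : IsVeryWeakSol (ζ ^ 2) v (fun x => a x * w x) :=
      (isVeryWeakSol_greenConv hζ iw).congr ev.symm EventuallyEq.rfl
    exact ((isVeryWeakSol_of_mem_graph_resolventOp h1 hζ hy).sub wv (h1.expIntegrable_coe y)
      (h1.expIntegrable_coe g) (h1.expIntegrable_coe v) iw).congr eu.symm EventuallyEq.rfl

/-- If `u = 0` then `w = b u = 0`, and the equation reduces to `0 = g` as distributions. -/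
theorem eq_zero_of_mem_graph_perturbedResolvent [q.HolderConjugate p]
    (h1 : ExpMemLp q (fun _ => 1)) (ha : ExpMemLp q a) (hζ : 0 < ζ.im)
    (hreg : IsRegularPoint (borderedResolvent p a b (ζ ^ 2)) (-1)) (g : LpC p)
    (h : (g, (0 : LpC p)) ∈ (perturbedResolvent p a b (ζ ^ 2)).graph) : g = 0 := by
  obtain ⟨w, hw, hsol⟩ := exists_of_mem_graph_perturbedResolvent h1 ha hζ hreg h
  have e0 := Lp.coeFn_zero ℂ p (volume : Measure E3)
  have hsol' : IsVeryWeakSol (ζ ^ 2) (fun _ => 0) g := by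
    refine hsol.congr e0 ?_
    filter_upwards [hw, e0] with x x1 x2
    rw [x1, x2]
    simp
  rw [Lp.eq_zero_iff_ae_eq_zero]
  refine ae_eq_zero_of_integral_contDiff_smul_eq_zero
    (h1.expIntegrable_coe g).locallyIntegrable fun φ hφ hc => ?_
  have := hsol' (fun x => (φ x : ℂ)) (Complex.ofRealCLM.contDiff.comp hφ)
    (hc.comp_left (g := fun t : ℝ => (t : ℂ)) (by simp))
  simp only [zero_mul, integral_zero] at this
  simpa only [Complex.real_smul, mul_comm] using this.symm

/-- An eigenfunction `u` of the Schrödinger operator satisfies `b u ∈ L_p` and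
`-Δu - λu = -a (b u)`. -/
theorem IsSchrodingerOperator.exists_eigenfunction [q.HolderConjugate p]
    (h1 : ExpMemLp q (fun _ => 1)) (ha : ExpMemLp q a) {H : LpC p →ₗ.[ℂ] LpC p}
    (hH : IsSchrodingerOperator p a b H) {l : ℂ} (hl : IsEigenvalueOf H l) :
    ∃ u w : LpC p, u ≠ 0 ∧ w =ᵐ[volume] (fun x => b x * u x) ∧
      IsVeryWeakSol l u (fun x => -(a x * w x)) := by
  obtain ⟨z, hz, hreg, rfl⟩ := hH
  obtain ⟨ζ, rfl, hζ⟩ := exists_sqrt_im_pos hz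
  obtain ⟨u, hu0, hu⟩ := hl
  have hg := LinearPMap.mem_graph _ u
  have hinj : ∀ x : LpC p, (x, 0) ∈ (perturbedResolvent p a b (ζ ^ 2)).graph → x = 0 := fun x hx =>
    eq_zero_of_mem_graph_perturbedResolvent h1 ha hζ hreg x hx
  -- The eigenvalue equation becomes: the perturbed resolvent maps `(l - ζ²) u` to `u`.
  rw [hu, mem_graph_shiftOp, mem_graph_inverse hinj] at hg
  obtain ⟨w, hw, hsol⟩ := exists_of_mem_graph_perturbedResolvent h1 ha hζ hreg hg
  refine ⟨u, w, hu0, hw, ?_⟩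
  have iu := h1.expIntegrable_coe (u : LpC p)
  have := hsol.shift iu ((h1.expIntegrable_coe _).sub (ha.expIntegrable_mul w)) l
  refine this.congr EventuallyEq.rfl ?_
  filter_upwards [Lp.coeFn_add (l • (u : LpC p)) ((-ζ ^ 2) • (u : LpC p)),
    Lp.coeFn_smul l (u : LpC p), Lp.coeFn_smul (-ζ ^ 2) (u : LpC p)] with x e1 e2 e3
  rw [e1, Pi.add_apply, e2, e3, Pi.smul_apply, Pi.smul_apply, smul_eq_mul, smul_eq_mul]
  ring

end Resolvent

/-! ### The eigenvalue bound -/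

theorem lintegral_mul_yukawa_le {ρ A : ℝ≥0∞} [ρ.HolderConjugate A] {Q : E3 → ℂ}
    (hQ : AEStronglyMeasurable Q volume) (κ : ℝ) (y : E3) :
    ∫⁻ x, ‖Q x‖ₑ * ENNReal.ofReal (yukawa κ (x - y)) ≤
      eLpNorm Q ρ volume * eLpNorm (yukawa κ) A volume := by
  have hmp := measurePreserving_sub_right (volume : Measure E3) y
  have hm := (measurable_yukawa κ).aestronglyMeasurable (μ := (volume : Measure E3))
  have hm' : AEStronglyMeasurable (fun x => ((yukawa κ (x - y) : ℝ) : ℂ)) volume :=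
    Complex.continuous_ofReal.comp_aestronglyMeasurable (hm.comp_measurePreserving hmp)
  have h := eLpNorm_smul_le_mul_eLpNorm (p := ρ) (q := A) (r := 1) hm' hQ
  have h2 : eLpNorm (fun x => ((yukawa κ (x - y) : ℝ) : ℂ)) A volume =
      eLpNorm (yukawa κ) A volume := by
    rw [← eLpNorm_comp_measurePreserving hm hmp]
    exact eLpNorm_congr_norm_ae (Eventually.of_forall fun x => by simp)
  rw [h2, eLpNorm_one_eq_lintegral_enorm] at h
  refine le_trans (lintegral_mono fun x => le_of_eq ?_) h
  rw [Pi.smul_apply', smul_eq_mul, enorm_mul, ← ofReal_norm ((yukawa κ (x - y) : ℝ) : ℂ),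
    Complex.norm_real, Real.norm_of_nonneg (yukawa_nonneg _ _)]

/-- A Schur test in weighted `L_1`: by Tonelli integrate in `x` first, move the weight to `y`, and
bound the remaining `x`-integral by Hölder uniformly in `y`. -/
theorem lintegral_exp_mul_yukawa_potential_le {ρ A : ℝ≥0∞} [ρ.HolderConjugate A] {Q : E3 → ℂ}
    (hQ : AEStronglyMeasurable Q volume) {κ c : ℝ} (hc : 0 ≤ c) {f : E3 → ℝ≥0∞}
    (hf : AEMeasurable f volume) :
    ∫⁻ x, ENNReal.ofReal (Real.exp (-c * ‖x‖)) *
        (‖Q x‖ₑ * ∫⁻ y, ENNReal.ofReal (yukawa κ (x - y)) * f y) ≤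
      (eLpNorm Q ρ volume * eLpNorm (yukawa (κ - c)) A volume) *
        ∫⁻ y, ENNReal.ofReal (Real.exp (-c * ‖y‖)) * f y := by
  have hym : ∀ κ, Measurable fun q : E3 × E3 => ENNReal.ofReal (yukawa κ (q.1 - q.2)) := fun κ =>
    ((measurable_yukawa κ).comp (measurable_fst.sub measurable_snd)).ennreal_ofReal
  have hm : AEMeasurable (Function.uncurry fun x y : E3 => ENNReal.ofReal (Real.exp (-c * ‖x‖)) *
      (‖Q x‖ₑ * (ENNReal.ofReal (yukawa κ (x - y)) * f y))) (volume.prod volume) :=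
    ((by fun_prop : Measurable fun q : E3 × E3 =>
      ENNReal.ofReal (Real.exp (-c * ‖q.1‖))).aemeasurable).mul
      (hQ.enorm.comp_fst.mul ((hym κ).aemeasurable.mul hf.comp_snd))
  have hy1 : ∀ x, AEMeasurable (fun y => ENNReal.ofReal (yukawa κ (x - y)) * f y) volume :=
    fun x => ((hym κ).comp measurable_prodMk_left).aemeasurable.mul hf
  have he : AEMeasurable (fun y : E3 => ENNReal.ofReal (Real.exp (-c * ‖y‖)) * f y) volume :=
    (by fun_prop : Measurable fun y : E3 =>
      ENNReal.ofReal (Real.exp (-c * ‖y‖))).aemeasurable.mul hf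
  calc _ = ∫⁻ x, ∫⁻ y, ENNReal.ofReal (Real.exp (-c * ‖x‖)) *
          (‖Q x‖ₑ * (ENNReal.ofReal (yukawa κ (x - y)) * f y)) := by
        refine lintegral_congr fun x => ?_
        rw [lintegral_const_mul' _ _ ENNReal.ofReal_ne_top,
          lintegral_const_mul' _ _ enorm_ne_top]
    _ = ∫⁻ y, ∫⁻ x, ENNReal.ofReal (Real.exp (-c * ‖x‖)) *
          (‖Q x‖ₑ * (ENNReal.ofReal (yukawa κ (x - y)) * f y)) := lintegral_lintegral_swap hm
    _ ≤ ∫⁻ y, (eLpNorm Q ρ volume * eLpNorm (yukawa (κ - c)) A volume) *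
          (ENNReal.ofReal (Real.exp (-c * ‖y‖)) * f y) := by
        refine lintegral_mono fun y => ?_
        have hmy : AEMeasurable (fun x => ‖Q x‖ₑ * ENNReal.ofReal (yukawa (κ - c) (x - y)))
            volume := hQ.enorm.mul ((hym (κ - c)).comp measurable_prodMk_right).aemeasurable
        calc _ ≤ ∫⁻ x, (‖Q x‖ₑ * ENNReal.ofReal (yukawa (κ - c) (x - y))) *
              (ENNReal.ofReal (Real.exp (-c * ‖y‖)) * f y) := by
              refine lintegral_mono fun x => ?_
              have h1 : ENNReal.ofReal (Real.exp (-c * ‖x‖)) * ENNReal.ofReal (yukawa κ (x - y)) ≤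
                  ENNReal.ofReal (yukawa (κ - c) (x - y)) *
                    ENNReal.ofReal (Real.exp (-c * ‖y‖)) := by
                rw [← ENNReal.ofReal_mul (Real.exp_nonneg _),
                  ← ENNReal.ofReal_mul (yukawa_nonneg _ _), ← exp_mul_yukawa c]
                refine ENNReal.ofReal_le_ofReal ?_
                have := mul_le_mul_of_nonneg_right (exp_neg_norm_le c hc x y)
                  (yukawa_nonneg κ (x - y))
                linarith
              calc _ = (ENNReal.ofReal (Real.exp (-c * ‖x‖)) *
                    ENNReal.ofReal (yukawa κ (x - y))) * (‖Q x‖ₑ * f y) := by ring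
                _ ≤ (ENNReal.ofReal (yukawa (κ - c) (x - y)) *
                    ENNReal.ofReal (Real.exp (-c * ‖y‖))) * (‖Q x‖ₑ * f y) := by gcongr
                _ = _ := by ring
          _ = (∫⁻ x, ‖Q x‖ₑ * ENNReal.ofReal (yukawa (κ - c) (x - y))) *
              (ENNReal.ofReal (Real.exp (-c * ‖y‖)) * f y) := lintegral_mul_const'' _ hmy
          _ ≤ _ := by
              gcongr
              exact lintegral_mul_yukawa_le hQ _ y
    _ = _ := lintegral_const_mul'' _ he

/-- If `u = -G ∗ g` with `g = Q u` and `u ≠ 0`, then `‖G_c‖_A ‖Q‖_ρ ≥ 1` for the kernel `G_c` with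
decay rate reduced by any `c > 0`. -/
theorem one_le_eLpNorm_mul_eLpNorm_yukawa {ρ A : ℝ≥0∞} [ρ.HolderConjugate A] {ζ : ℂ}
    {Q u g : E3 → ℂ} (hQ : AEStronglyMeasurable Q volume) (hg : ExpIntegrable g)
    (hgu : g =ᵐ[volume] fun x => Q x * u x)
    (hug : u =ᵐ[volume] greenConv ζ (fun x => -g x)) (hu : ¬u =ᵐ[volume] 0) {c : ℝ}
    (hc : 0 < c) :
    1 ≤ eLpNorm Q ρ volume * eLpNorm (yukawa (ζ.im - c)) A volume := by
  set I := ∫⁻ x, ENNReal.ofReal (Real.exp (-c * ‖x‖)) * ‖g x‖ₑ with hI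
  have hIt : I < ⊤ := by
    have := (hg c hc).2
    simp only [HasFiniteIntegral, enorm_exp_smul] at this
    exact this
  have hem : Measurable fun x : E3 => ENNReal.ofReal (Real.exp (-c * ‖x‖)) := by fun_prop
  -- If `I = 0` then `g = 0` almost everywhere, and so is its potential `u`.
  have hI0 : I ≠ 0 := by
    intro h0
    have hme : AEMeasurable (fun x : E3 => ENNReal.ofReal (Real.exp (-c * ‖x‖)) * ‖g x‖ₑ) volume :=
      hem.aemeasurable.mul hg.aestronglyMeasurable.enorm
    rw [hI, lintegral_eq_zero_iff' hme] at h0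
    have hg0 : (fun x => -g x) =ᵐ[volume] fun _ => 0 := by
      filter_upwards [h0] with x hx
      simpa [Real.exp_pos, Real.exp_pos _ |>.not_ge] using hx
    refine hu ?_
    rw [greenConv_congr hg0] at hug
    filter_upwards [hug] with x hx
    simp [hx, greenConv]
  have hle : I ≤ (eLpNorm Q ρ volume * eLpNorm (yukawa (ζ.im - c)) A volume) * I := by
    refine le_trans ?_ (lintegral_exp_mul_yukawa_potential_le hQ hc.le
      hg.aestronglyMeasurable.enorm)
    refine lintegral_mono_ae ?_
    filter_upwards [hgu, hug] with x h1 h2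
    gcongr
    rw [h1, enorm_mul]
    gcongr
    rw [h2]
    refine (enorm_integral_le_lintegral_enorm _).trans (lintegral_mono fun y => le_of_eq ?_)
    rw [enorm_mul, enorm_neg, ← ofReal_norm (greenKernel ζ (x - y)), norm_greenKernel]
  -- Since `0 < I < ∞`, the factor in `I ≤ (factor) * I` cannot be below one.
  by_contra! hlt
  have := ENNReal.mul_lt_mul_left hI0 hIt.ne hlt
  rw [one_mul] at this
  exact absurd hle this.not_ge

/-- Raise to the power `α` and let `c → 0`; the limit is harmless because `x ^ (α - 3)` is
continuous at `ακ > 0`. -/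
theorem one_le_rpow_bound {α κ N : ℝ} (hα : 0 < α) (hκ : 0 < κ) (hN : 0 ≤ N)
    (h : ∀ c, 0 < c → c < κ → 1 ≤ N * ((4 * Real.pi) ^ (1 - α) * Real.Gamma (3 - α) *
      (α * (κ - c)) ^ (α - 3)) ^ α⁻¹) (hΓ : 0 ≤ Real.Gamma (3 - α)) :
    1 ≤ (4 * Real.pi) ^ (1 - α) * Real.Gamma (3 - α) * (α * κ) ^ (α - 3) * N ^ α := by
  have hpi : 0 ≤ 4 * Real.pi := by positivity
  have hlim : Tendsto (fun c => (4 * Real.pi) ^ (1 - α) * Real.Gamma (3 - α) *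
      (α * (κ - c)) ^ (α - 3) * N ^ α) (𝓝[>] 0) (𝓝 ((4 * Real.pi) ^ (1 - α) *
        Real.Gamma (3 - α) * (α * κ) ^ (α - 3) * N ^ α)) := by
    have h1 : Tendsto (fun c => α * (κ - c)) (𝓝[>] 0) (𝓝 (α * κ)) := by
      have : Continuous fun c => α * (κ - c) := by fun_prop
      simpa using (this.tendsto 0).mono_left (nhdsWithin_le_nhds (s := Set.Ioi 0))
    exact ((h1.rpow_const (Or.inl (by positivity))).const_mul _).mul_const _
  refine ge_of_tendsto hlim ?_
  filter_upwards [Ioo_mem_nhdsGT hκ] with c hc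
  have hκc : 0 < κ - c := sub_pos.2 hc.2
  set D := (4 * Real.pi) ^ (1 - α) * Real.Gamma (3 - α) * (α * (κ - c)) ^ (α - 3)
  have hD : 0 ≤ D := mul_nonneg (mul_nonneg (by positivity) hΓ) (by positivity)
  have h2 := Real.one_le_rpow (h c hc.1 hc.2) hα.le
  rw [Real.mul_rpow hN (Real.rpow_nonneg hD _), ← Real.rpow_mul hD, inv_mul_cancel₀ hα.ne',
    Real.rpow_one] at h2
  rwa [mul_comm]

theorem rpow_le_of_one_le {α L σ C N M : ℝ} (hα : 0 < α) (hL : 0 < L) (hσ : 0 < σ)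
    (h : 1 ≤ C * (α * (√L * σ)) ^ (α - 3) * (N * M)) :
    L ^ ((3 - α) / 2) ≤ C * (α * σ) ^ (α - 3) * N * M := by
  have hpow : (α * (√L * σ)) ^ (α - 3) = (α * σ) ^ (α - 3) * (L ^ ((3 - α) / 2))⁻¹ := by
    rw [show α * (√L * σ) = (α * σ) * √L by ring, Real.mul_rpow (by positivity)
      (Real.sqrt_nonneg _), Real.sqrt_eq_rpow, ← Real.rpow_mul hL.le, ← Real.rpow_neg hL.le]
    ring_nf
  have hL' : 0 < L ^ ((3 - α) / 2) := by positivity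
  rw [hpow] at h
  calc L ^ ((3 - α) / 2) = L ^ ((3 - α) / 2) * 1 := (mul_one _).symm
    _ ≤ _ := mul_le_mul_of_nonneg_left h hL'.le
    _ = _ := by field_simp

theorem mainTheorem1 (p r s : ℝ≥0∞) [Fact (1 ≤ p)] (hp : 1 < p) (hp_top : p < ⊤)
    (hr : 0 < r) (hps : p ≤ s) (hrs : r⁻¹ + s⁻¹ < 2 / 3)
    (a b : E3 → ℂ) (ha : MemLp a r volume) (hb : MemLp b s volume)
    -- standing assumptions: `a` and `b` are of Stummel class, and `q = a b` decays at infinity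
    (ha_stummel : ∃ ν : ℝ, 0 < ν ∧ ν < p.toReal.conjExponent ∧
      stummel ν p.toReal.conjExponent a < ⊤)
    (hb_stummel : ∃ μ : ℝ, 0 < μ ∧ μ < p.toReal ∧ stummel μ p.toReal b < ⊤)
    (hq : Tendsto (fun x : E3 => ∫⁻ y in Metric.ball x 1, ‖a y * b y‖ₑ) (cocompact E3) (𝓝 0))
    (H : LpC p →ₗ.[ℂ] LpC p) (hH : IsSchrodingerOperator p a b H)
    (lam : ℂ) (h_eig : IsEigenvalueOf H lam) (h_lam : lam ∉ ((↑) : ℝ → ℂ) '' Set.Ici 0)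
    (θ : ℝ) (hθ : θ ∈ Set.Ioo 0 (2 * Real.pi))
    (h_arg : lam = (‖lam‖ : ℂ) * Complex.exp ((θ : ℂ) * Complex.I))
    (α : ℝ) (hα : α = (1 - r⁻¹.toReal - s⁻¹.toReal)⁻¹) :
    ‖lam‖ ^ ((3 - α) / 2) ≤
      (4 * Real.pi) ^ (1 - α) * Real.Gamma (3 - α) * (α * Real.sin (θ / 2)) ^ (α - 3) *
        (eLpNorm a r volume).toReal ^ α * (eLpNorm b s volume).toReal ^ α := by
  obtain ⟨ν, -, -, hν⟩ := ha_stummel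
  -- the dual exponent of `p`
  have hp1 : 1 < p.toReal := by
    rw [← ENNReal.toReal_one]
    exact (ENNReal.toReal_lt_toReal ENNReal.one_ne_top hp_top.ne).2 hp
  have hconj := Real.HolderConjugate.conjExponent hp1
  have : (ENNReal.ofReal p.toReal.conjExponent).HolderConjugate p := by
    have := hconj.symm.ennrealOfReal
    rwa [ENNReal.ofReal_toReal hp_top.ne] at this
  have hone : ExpMemLp (ENNReal.ofReal p.toReal.conjExponent) (fun _ => 1) := fun c hc =>
    memLp_exp_smul_one hconj.symm.pos hc
  have haE : ExpMemLp (ENNReal.ofReal p.toReal.conjExponent) a := fun c hc =>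
    memLp_exp_smul_of_stummel hconj.symm.pos ha.1 hν hc
  -- the exponent `α`
  have hri : r⁻¹ ≠ ⊤ := ENNReal.inv_ne_top.2 hr.ne'
  have hsi : s⁻¹ ≠ ⊤ := ENNReal.inv_ne_top.2 (zero_lt_one.trans (hp.trans_le hps)).ne'
  have hx : r⁻¹.toReal + s⁻¹.toReal < 2 / 3 := by
    rw [← ENNReal.toReal_add hri hsi]
    have h23 : (2 / 3 : ℝ≥0∞).toReal = 2 / 3 := by simp
    rw [← h23]
    exact (ENNReal.toReal_lt_toReal (ENNReal.add_ne_top.2 ⟨hri, hsi⟩)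
      (ENNReal.div_ne_top (by simp) (by simp))).2 hrs
  have hx0 : 0 ≤ r⁻¹.toReal + s⁻¹.toReal := by positivity
  have hαi : α⁻¹ = 1 - r⁻¹.toReal - s⁻¹.toReal := by rw [hα, inv_inv]
  have hαi0 : 0 < α⁻¹ := by linarith
  have hα0 : 0 < α := inv_pos.1 hαi0
  have hα3 : α < 3 := by
    rw [← inv_lt_inv₀ (by norm_num) hα0]
    linarith
  have hrs' : ENNReal.HolderTriple r s (r⁻¹ + s⁻¹)⁻¹ := ⟨(inv_inv _).symm⟩
  -- The exponent `ρ` of `q = ab` is conjugate to `α`; if `r = s = ∞` then `ρ = ∞` and `α = 1`.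
  have : ENNReal.HolderConjugate (r⁻¹ + s⁻¹)⁻¹ (ENNReal.ofReal α) := by
    refine ⟨?_⟩
    rw [inv_inv, inv_one, ← ENNReal.ofReal_inv_of_pos hα0,
      ← ENNReal.ofReal_toReal (ENNReal.add_ne_top.2 ⟨hri, hsi⟩), ENNReal.toReal_add hri hsi,
      ← ENNReal.ofReal_add hx0 hαi0.le, hαi]
    simp
  -- the square root of the eigenvalue
  have hlam0 : 0 < ‖lam‖ := norm_pos_iff.2 fun h => h_lam ⟨0, Set.mem_Ici.2 le_rfl, by simp [h]⟩
  have hsin : 0 < Real.sin (θ / 2) :=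
    Real.sin_pos_of_pos_of_lt_pi (by linarith [hθ.1]) (by linarith [hθ.2])
  -- Halving the argument puts the root in the upper half-plane, since `θ/2 ∈ (0, π)`; this is the
  -- source of `sin (θ/2)` in the bound.
  obtain ⟨ζ, hζ2, hζi⟩ : ∃ ζ : ℂ, ζ ^ 2 = lam ∧ ζ.im = √‖lam‖ * Real.sin (θ / 2) := by
    refine ⟨(√‖lam‖ : ℝ) * Complex.exp ((θ / 2 : ℝ) * Complex.I), ?_, ?_⟩
    · rw [mul_pow, ← Complex.ofReal_pow, Real.sq_sqrt (norm_nonneg _), ← Complex.exp_nat_mul]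
      conv_rhs => rw [h_arg]
      congr 2
      push_cast
      ring
    · rw [Complex.im_ofReal_mul, Complex.exp_ofReal_mul_I_im]
  have hζ : 0 < ζ.im := by rw [hζi]; positivity
  -- the eigenfunction
  obtain ⟨u, w, hu0, hw, hsol⟩ := hH.exists_eigenfunction hone haE h_eig
  rw [← hζ2] at hsol
  have iw := haE.expIntegrable_mul w
  have hug := hsol.ae_eq_greenConv hζ (hone.expIntegrable_coe u) iw.neg
  have hgu : (fun x => a x * w x) =ᵐ[volume] fun x => (a x * b x) * u x := by
    filter_upwards [hw] with x hx
    rw [hx, mul_assoc]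
  have hune : ¬(u : E3 → ℂ) =ᵐ[volume] 0 := fun h => hu0 ((Lp.eq_zero_iff_ae_eq_zero).2 h)
  have hQm : AEStronglyMeasurable (fun x => a x * b x) volume := ha.1.mul hb.1
  have hab : eLpNorm (fun x => a x * b x) (r⁻¹ + s⁻¹)⁻¹ volume ≤
      eLpNorm a r volume * eLpNorm b s volume :=
    eLpNorm_smul_le_mul_eLpNorm (p := r) (q := s) (φ := a) (f := b) hb.1 ha.1
      (hpqr := hrs')
  set N := (eLpNorm a r volume).toReal * (eLpNorm b s volume).toReal with hN
  have hΓ : 0 < Real.Gamma (3 - α) := Real.Gamma_pos_of_pos (by linarith)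
  have hbound : ∀ c, 0 < c → c < ζ.im → 1 ≤ N * ((4 * Real.pi) ^ (1 - α) * Real.Gamma (3 - α) *
      (α * (ζ.im - c)) ^ (α - 3)) ^ α⁻¹ := by
    intro c hc hcζ
    have h1 : 1 ≤ eLpNorm (fun x => a x * b x) (r⁻¹ + s⁻¹)⁻¹ volume *
        eLpNorm (yukawa (ζ.im - c)) (ENNReal.ofReal α) volume :=
      one_le_eLpNorm_mul_eLpNorm_yukawa hQm iw hgu hug hune hc
    rw [eLpNorm_yukawa (sub_pos.2 hcζ) hα0 hα3] at h1
    have h2 := h1.trans (mul_le_mul_left hab _)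
    rw [← ENNReal.ofReal_toReal (ENNReal.mul_lt_top ha.2 hb.2).ne, ENNReal.toReal_mul,
      ← ENNReal.ofReal_mul (by positivity)] at h2
    exact ENNReal.one_le_ofReal.1 h2
  have hfin := one_le_rpow_bound hα0 hζ (by positivity) hbound hΓ.le
  rw [hN, Real.mul_rpow ENNReal.toReal_nonneg ENNReal.toReal_nonneg, hζi] at hfin
  exact rpow_le_of_one_le hα0 hlam0 hsin hfin
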